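/- **Conventions.** $\mathcal F[u](\xi)=\frac1{\sqrt{2\pi}}\int_{\mathbb R}e^{-ix\xi}u(x)\,dx$ and $\mathcal F^{-1}[u](x)=\frac1{\sqrt{2\pi}}\int_{\mathbb R}e^{ix\xi}u(\xi)\,d\xi$ on $\mathcal S(\mathbb R)$, extended to $\mathcal S'(\mathbb R)$ by duality. A cut-off function is a smooth, compactly supported $\omega:\mathbb R\to\mathbb R$ with $\omega=1$ near $0$. For $a\in\mathbb C$, $(\xi\mp i0)^a:=\lim_{\eta\to0^+}(\xi\mp i\eta)^a$ in the sense of distributions (principal branch). For $\operatorname{Re}s>-1$, $x_\pm^s$ is the function equal to $|x|^s$ for $\pm x>0$ and to $0$ otherwise; for other $s\notin\mathbb Z_{<0}$, $x_\pm^s=\frac{(\pm1)^k\partial_x^k\,x_\pm^{s+k}}{(s+1)\cdots(s+k)}$ with $\operatorname{Re}s+k>-1$; for $s\in\mathbb Z_{<0}$, $x_\pm^{s}$ is the finite part (the pole in $s$ is subtracted). The quotient $x_\pm^{s}/\Gamma(s+1)$ denotes the family of tempered distributions that is entire in $s$, namely $(\pm1)^k\partial_x^k x_\pm^{s+k}/\Gamma(s+k+1)$;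 at $s=-n-1$, $n\in\mathbb N=\{0,1,2,\dots\}$, it is $(\pm1)^n\delta_0^{(n)}$. A function $h$ is $O([x]^{-\infty})$ if $h(x)=O(|x|^{-N})$ as $|x|\to\infty$ for every $N$. Signs $\pm$, $\mp$ are read all upper or all lower. **Proposition.** Let $\omega$ be a cut-off function and $a\in\mathbb C$. The limit $(\xi\mp i0)^a$ exists in $\mathcal S'(\mathbb R)$, and: 1. $$\mathcal F^{-1}[(\xi\mp i0)^a]=\frac{\sqrt{2\pi}}{\Gamma(-a)}\,e^{\mp i\pi a/2}\,x_\pm^{-a-1},$$ where for $a\in\mathbb N$ the quotient $x_\pm^{-a-1}/\Gamma(-a)$ is the value of the entire family above. Moreover $\mathcal F^{-1}[\mathcal F[x_\pm^a]]=x_\pm^a$. 2. $\mathcal F^{-1}[\omega\,(\xi\mp i0)^a]$ is a smooth function on $\mathbb R$. On $\mathbb R\setminus\{0\}$ the distribution $\mathcal F^{-1}[(1-\omega)(\xi\mp i0)^a]$ is a smooth function, and it is $O([x]^{-\infty})$. 3. $\mathcal F^{-1}[(\xi\mp i0)^a]=\mathcal F^{-1}[\omega(\xi\mp i0)^a]+\mathcal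 F^{-1}[(1-\omega)(\xi\mp i0)^a]$, and, as functions of $x$ with $|x|\to\infty$, $$\mathcal F^{-1}[\omega(\xi\mp i0)^a](x)=\frac{\sqrt{2\pi}}{\Gamma(-a)}\,e^{\mp i\pi a/2}\,x_\pm^{-a-1}+O([x]^{-\infty})$$ (with $1/\Gamma(-a)=0$ if $a\in\mathbb N$). 4. $$\frac{d}{dx}\mathcal F^{-1}[(\xi\mp i0)^a]=i\,\mathcal F^{-1}[(\xi\mp i0)^{a+1}].$$ -/

import Mathlib

open MeasureTheory Filter Topology
open scoped SchwartzMap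

noncomputable section

namespace HomDist

/-! ### Fourier transform with the normalisation `(2π)^(-1/2) ∫ e^{∓ i x ξ}` -/

/-- The dilation `x ↦ x / (2π)` of the line. -/
def dilation : ℝ ≃L[ℝ] ℝ :=
  ContinuousLinearEquiv.unitsEquivAut ℝ (Units.mk0 (2 * Real.pi)⁻¹ (by positivity))

/-- The Fourier transform `u ↦ (2π)^(-1/2) ∫ e^{-i x ξ} u(x) dx` on Schwartz functions. -/
def fourierS : 𝓢(ℝ, ℂ) →L[ℂ] 𝓢(ℝ, ℂ) :=
  ((Real.sqrt (2 * Real.pi) : ℂ)⁻¹) •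
    (SchwartzMap.compCLMOfContinuousLinearEquiv ℂ dilation ∘L
      FourierTransform.fourierCLM ℂ 𝓢(ℝ, ℂ))

/-- The inverse Fourier transform `u ↦ (2π)^(-1/2) ∫ e^{i x ξ} u(ξ) dξ` on Schwartz functions. -/
def invFourierS : 𝓢(ℝ, ℂ) →L[ℂ] 𝓢(ℝ, ℂ) :=
  ((Real.sqrt (2 * Real.pi) : ℂ)⁻¹) •
    (SchwartzMap.compCLMOfContinuousLinearEquiv ℂ dilation ∘L
      FourierTransform.fourierInvCLM ℂ 𝓢(ℝ, ℂ))

theorem fourierS_apply (u : 𝓢(ℝ, ℂ)) (ξ : ℝ) :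
    fourierS u ξ = (Real.sqrt (2 * Real.pi) : ℂ)⁻¹ *
      ∫ x : ℝ, Complex.exp (-Complex.I * x * ξ) * u x := by
  have h : fourierS u ξ = (Real.sqrt (2 * Real.pi) : ℂ)⁻¹ *
      (FourierTransform.fourier u) (ξ * (2 * Real.pi)⁻¹) := rfl
  rw [h, SchwartzMap.fourier_coe, Real.fourier_eq']
  congr 1
  refine integral_congr_ae (Eventually.of_forall fun x => ?_)
  simp only [smul_eq_mul, RCLike.inner_apply, conj_trivial]
  congr 2
  push_cast
  have : (Real.pi : ℂ) ≠ 0 := by exact_mod_cast Real.pi_ne_zero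
  field_simp

theorem invFourierS_apply (u : 𝓢(ℝ, ℂ)) (x : ℝ) :
    invFourierS u x = (Real.sqrt (2 * Real.pi) : ℂ)⁻¹ *
      ∫ ξ : ℝ, Complex.exp (Complex.I * x * ξ) * u ξ := by
  have h : invFourierS u x = (Real.sqrt (2 * Real.pi) : ℂ)⁻¹ *
      (FourierTransform.fourierInv u) (x * (2 * Real.pi)⁻¹) := rfl
  rw [h, SchwartzMap.fourierInv_coe, Real.fourierInv_eq']
  congr 1
  refine integral_congr_ae (Eventually.of_forall fun ξ => ?_)
  simp only [smul_eq_mul, RCLike.inner_apply, conj_trivial]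
  congr 2
  push_cast
  have : (Real.pi : ℂ) ≠ 0 := by exact_mod_cast Real.pi_ne_zero
  field_simp

/-- The Fourier transform on tempered distributions, `⟨F T, φ⟩ = ⟨T, F φ⟩`. -/
def fourierD : 𝓢'(ℝ, ℂ) →L[ℂ] 𝓢'(ℝ, ℂ) :=
  PointwiseConvergenceCLM.precomp ℂ fourierS

/-- The inverse Fourier transform on tempered distributions, `⟨F⁻¹ T, φ⟩ = ⟨T, F⁻¹ φ⟩`. -/
def invFourierD : 𝓢'(ℝ, ℂ) →L[ℂ] 𝓢'(ℝ, ℂ) :=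
  PointwiseConvergenceCLM.precomp ℂ invFourierS

/-- The `k`-th distributional derivative. -/
def iterDeriv (k : ℕ) (T : 𝓢'(ℝ, ℂ)) : 𝓢'(ℝ, ℂ) :=
  (TemperedDistribution.derivCLM ℂ)^[k] T

/-! ### Functions as tempered distributions -/

/-- `f` is integrable against some power of `(1 + |x|)⁻¹`. -/
def PolyIntegrable (f : ℝ → ℂ) : Prop :=
  ∃ k : ℕ, Integrable (fun x : ℝ => ((((1 + |x|) ^ k)⁻¹ : ℝ) : ℂ) * f x)

theorem PolyIntegrable.exists_bound {f : ℝ → ℂ} (hf : PolyIntegrable f) :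
    ∃ (s : Finset (ℕ × ℕ)) (C : ℝ), 0 ≤ C ∧ ∀ φ : 𝓢(ℝ, ℂ),
      Integrable (fun x => φ x * f x) ∧
      ‖∫ x, φ x * f x‖ ≤ C * (s.sup (schwartzSeminormFamily ℂ ℝ ℂ)) φ := by
  obtain ⟨k, hk⟩ := hf
  refine ⟨Finset.Iic (k, 0),
    2 ^ k * ∫ x : ℝ, ‖((((1 + |x|) ^ k)⁻¹ : ℝ) : ℂ) * f x‖, by positivity, fun φ => ?_⟩
  set S := ((Finset.Iic (k, 0)).sup (schwartzSeminormFamily ℂ ℝ ℂ)) φ with hS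
  have hb : ∀ x : ℝ, ‖φ x * ((1 + |x|) ^ k : ℝ)‖ ≤ 2 ^ k * S := by
    intro x
    have := SchwartzMap.one_add_le_sup_seminorm_apply (𝕜 := ℂ) (m := (k, 0)) le_rfl le_rfl φ x
    rw [norm_iteratedFDeriv_zero] at this
    rw [norm_mul, Complex.norm_real, Real.norm_of_nonneg (by positivity), mul_comm]
    exact this
  have he : (fun x => φ x * f x) = fun x : ℝ =>
      (φ x * ((1 + |x|) ^ k : ℝ)) * (((((1 + |x|) ^ k)⁻¹ : ℝ) : ℂ) * f x) := by
    funext x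
    have h1 : (((1 + |x|) ^ k : ℝ) : ℂ) ≠ 0 := by
      exact_mod_cast (by positivity : (1 + |x|) ^ k ≠ 0)
    rw [Complex.ofReal_inv]
    field_simp
  have hc : Continuous fun x : ℝ => φ x * (((1 + |x|) ^ k : ℝ) : ℂ) :=
    φ.continuous.mul (Complex.continuous_ofReal.comp (by fun_prop))
  have hi : Integrable (fun x => φ x * f x) := by
    rw [he]
    exact hk.bdd_mul hc.aestronglyMeasurable (Eventually.of_forall hb)
  refine ⟨hi, (norm_integral_le_integral_norm _).trans ?_⟩
  rw [mul_right_comm, ← integral_const_mul]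
  refine integral_mono hi.norm (hk.norm.const_mul _) fun x => ?_
  have := congrFun he x
  simp only at this ⊢
  rw [this, norm_mul]
  exact mul_le_mul_of_nonneg_right (hb x) (norm_nonneg _)

/-- The tempered distribution `φ ↦ ∫ φ f` of a function `f`. -/
def ofFun (f : ℝ → ℂ) (hf : PolyIntegrable f) : 𝓢'(ℝ, ℂ) :=
  ContinuousLinearMap.toPointwiseConvergenceCLM _ _ _ _ <|
    SchwartzMap.mkCLMtoNormedSpace (𝕜 := ℂ) (σ := RingHom.id ℂ) (fun φ : 𝓢(ℝ, ℂ) => ∫ x, φ x * f x)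
      (fun φ ψ => by
        obtain ⟨s, C, -, h⟩ := hf.exists_bound
        simp only [add_apply, add_mul]
        exact integral_add (h φ).1 (h ψ).1)
      (fun c φ => by
        simp only [smul_apply, smul_eq_mul, mul_assoc, RingHom.id_apply]
        exact integral_const_mul _ _)
      (by
        obtain ⟨s, C, hC, h⟩ := hf.exists_bound
        exact ⟨s, C, hC, fun φ => (h φ).2⟩)

theorem ofFun_apply (f : ℝ → ℂ) (hf : PolyIntegrable f) (φ : 𝓢(ℝ, ℂ)) :
    ofFun f hf φ = ∫ x, φ x * f x := rfl

theorem polyIntegrable_of_bound {f : ℝ → ℂ} (hm : Measurable f) {r C : ℝ} (hr : -1 < r) (m : ℕ)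
    (h0 : ∀ x : ℝ, x ≠ 0 → |x| < 1 → ‖f x‖ ≤ C * |x| ^ r)
    (h1 : ∀ x : ℝ, 1 ≤ |x| → ‖f x‖ ≤ C * |x| ^ m) : PolyIntegrable f := by
  have hC : 0 ≤ C := by simpa using (norm_nonneg _).trans (h1 1 (by simp))
  have hpos : IntegrableOn (fun x : ℝ => |x| ^ r) (Set.Ioc 0 1) := by
    have := (intervalIntegral.intervalIntegrable_rpow' (a := 0) (b := 1) hr).1
    refine this.congr_fun (fun x hx => ?_) measurableSet_Ioc
    simp only [abs_of_pos hx.1]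
  have hneg : IntegrableOn (fun x : ℝ => |x| ^ r) (Set.Ico (-1) 0) := by
    have := hpos.comp_neg
    simpa using this
  have hloc : IntegrableOn (fun x : ℝ => |x| ^ r) (Set.Ico (-1) 0 ∪ Set.Ioc 0 1) := hneg.union hpos
  have hloc' : Integrable ((Set.Ico (-1) 0 ∪ Set.Ioc 0 1).indicator fun x : ℝ => C * |x| ^ r) :=
    (integrable_indicator_iff (measurableSet_Ico.union measurableSet_Ioc)).2 (hloc.const_mul C)
  refine ⟨m + 2, (hloc'.add (integrable_inv_one_add_sq.const_mul C)).mono' (by fun_prop) ?_⟩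
  have hae : ∀ᵐ x : ℝ, x ≠ 0 := by simp [ae_iff]
  filter_upwards [hae] with x hx
  rw [norm_mul, Complex.norm_real, Real.norm_of_nonneg (by positivity)]
  have hs : 0 ≤ C * (1 + x ^ 2)⁻¹ := by positivity
  have hi : 0 ≤ (Set.Ico (-1) 0 ∪ Set.Ioc 0 1).indicator (fun x : ℝ => C * |x| ^ r) x :=
    Set.indicator_nonneg (fun y _ => by positivity) x
  simp only [Pi.add_apply]
  rcases lt_or_ge |x| 1 with h | h
  · have hxm : x ∈ Set.Ico (-1 : ℝ) 0 ∪ Set.Ioc 0 1 := by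
      rw [abs_lt] at h
      rcases lt_or_gt_of_ne hx with h' | h'
      · exact Or.inl ⟨h.1.le, h'⟩
      · exact Or.inr ⟨h', h.2.le⟩
    rw [Set.indicator_of_mem hxm]
    have : ((1 + |x|) ^ (m + 2))⁻¹ * ‖f x‖ ≤ 1 * ‖f x‖ := by
      refine mul_le_mul_of_nonneg_right (inv_le_one_of_one_le₀ ?_) (norm_nonneg _)
      exact one_le_pow₀ (by linarith [abs_nonneg x])
    linarith [h0 x hx h]
  · have h2 : ((1 + |x|) ^ (m + 2))⁻¹ * ‖f x‖ ≤ ((1 + |x|) ^ (m + 2))⁻¹ * (C * (1 + |x|) ^ m) := by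
      refine mul_le_mul_of_nonneg_left ((h1 x h).trans ?_) (by positivity)
      gcongr
      linarith
    have h3 : ((1 + |x|) ^ (m + 2))⁻¹ * (C * (1 + |x|) ^ m) = C * ((1 + |x|) ^ 2)⁻¹ := by
      have : (1 + |x|) ≠ 0 := by positivity
      rw [pow_add]
      field_simp
    have h4 : C * ((1 + |x|) ^ 2)⁻¹ ≤ C * (1 + x ^ 2)⁻¹ := by
      gcongr
      nlinarith [sq_abs x, abs_nonneg x]
    linarith

/-! ### The distributions `x_±^s`

The upper sign is `σ = 1`, the lower sign is `σ = -1`. -/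

/-- The real number `±1`. -/
def sgn (σ : ℤˣ) : ℝ := ((σ : ℤ) : ℝ)

/-- The function `x_±^s`, equal to `|x|^s` if `±x > 0` and to `0` otherwise. -/
def halfPow (σ : ℤˣ) (s : ℂ) (x : ℝ) : ℂ :=
  if 0 < sgn σ * x then ((|x| : ℝ) : ℂ) ^ s else 0

/-- The function equal to `log |x|` if `±x > 0` and to `0` otherwise. -/
def halfLog (σ : ℤˣ) (x : ℝ) : ℂ :=
  if 0 < sgn σ * x then ((Real.log |x| : ℝ) : ℂ) else 0

theorem halfPow_polyIntegrable (σ : ℤˣ) {s : ℂ} (hs : -1 < s.re) :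
    PolyIntegrable (halfPow σ s) := by
  have hb : ∀ x : ℝ, x ≠ 0 → ‖halfPow σ s x‖ ≤ 1 * |x| ^ s.re := by
    intro x hx
    unfold halfPow
    split_ifs
    · rw [Complex.norm_cpow_eq_rpow_re_of_pos (abs_pos.2 hx), one_mul]
    · rw [norm_zero]
      positivity
  refine polyIntegrable_of_bound ?_ hs ⌈s.re⌉₊ (fun x hx _ => hb x hx) (fun x hx => ?_)
  · unfold halfPow
    exact Measurable.ite (measurableSet_lt measurable_const (by fun_prop)) (by fun_prop)
      measurable_const
  · refine (hb x (abs_pos.1 (by linarith))).trans ?_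
    rw [one_mul, one_mul, ← Real.rpow_natCast]
    exact Real.rpow_le_rpow_of_exponent_le hx (Nat.le_ceil _)

theorem halfLog_polyIntegrable (σ : ℤˣ) : PolyIntegrable (halfLog σ) := by
  have hb : ∀ x : ℝ, ‖halfLog σ x‖ ≤ |(Real.log (|x|))| := by
    intro x
    unfold halfLog
    split_ifs
    · rw [Complex.norm_real, Real.norm_eq_abs]
    · rw [norm_zero]
      positivity
  refine polyIntegrable_of_bound (r := -(1 / 2)) (C := 2) ?_ (by norm_num) 1
    (fun x hx h => ?_) (fun x hx => ?_)
  · unfold halfLog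
    exact Measurable.ite (measurableSet_lt measurable_const (by fun_prop)) (by fun_prop)
      measurable_const
  · refine (hb x).trans ?_
    have hp := abs_pos.2 hx
    rw [abs_of_nonpos (Real.log_nonpos (abs_nonneg x) h.le), ← Real.log_inv]
    have := Real.log_le_rpow_div (x := |x|⁻¹) (by positivity) (ε := 1 / 2) (by norm_num)
    rw [Real.inv_rpow (abs_nonneg x), ← Real.rpow_neg (abs_nonneg x)] at this
    linarith
  · refine (hb x).trans ?_
    rw [abs_of_nonneg (Real.log_nonneg hx), pow_one]
    linarith [Real.log_le_sub_one_of_pos (show 0 < |x| by linarith)]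

/-- The least `k` with `Re s + k > -1`. -/
def shift (s : ℂ) : ℕ := ⌊-s.re⌋₊

theorem shift_spec (s : ℂ) : -1 < (s + (shift s : ℂ)).re := by
  have := Nat.lt_floor_add_one (-s.re)
  simp only [shift, Complex.add_re, Complex.natCast_re]
  linarith

/-- The distribution `(±1)^k ∂^k x_±^(s+k)` with `k = shift s`; it is the distribution given by the
function `x_±^s` if `Re s > -1`. -/
def derivHalfPow (σ : ℤˣ) (s : ℂ) : 𝓢'(ℝ, ℂ) :=
  ((sgn σ : ℂ) ^ shift s) •
    iterDeriv (shift s) (ofFun (halfPow σ (s + (shift s : ℂ))) (halfPow_polyIntegrable σ (shift_spec s)))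

/-- The distribution `x_±^s` for every `s ∈ ℂ`. If `s` is not a negative integer, it is
`(±1)^k ∂^k x_±^(s+k) / ((s+1) ⋯ (s+k))`. If `s = -k` is a negative integer, it is the finite part
at `s = -k` (the pole is subtracted), that is, for the upper sign,
`φ ↦ -1/(k-1)! ∫_0^∞ log x φ^(k)(x) dx + (1 + 1/2 + ⋯ + 1/(k-1)) φ^(k-1)(0)/(k-1)!`,
and its reflection for the lower sign. In the code `n = k - 1`, and
`shift s = k`. -/
def homPow (σ : ℤˣ) (s : ℂ) : 𝓢'(ℝ, ℂ) :=
  open Classical in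
  if ∃ n : ℕ, s = -((n : ℂ) + 1) then
    let n := shift s - 1
    ((-1 : ℂ) ^ n * (n.factorial : ℂ)⁻¹) •
      ((sgn σ : ℂ) ^ (n + 1) •
          iterDeriv (n + 1) (ofFun (halfLog σ) (halfLog_polyIntegrable σ)) +
        (((harmonic n : ℚ) : ℂ) * (sgn σ : ℂ) ^ n) •
          iterDeriv n (TemperedDistribution.delta 0))
  else (∏ j ∈ Finset.range (shift s), (s + (j : ℂ) + 1))⁻¹ • derivHalfPow σ s

/-- The analytic continuation to all `s ∈ ℂ` of `s ↦ x_±^s / Γ(s + 1)`: it is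
`(±1)^k ∂^k x_±^(s+k) / Γ(s + k + 1)` with `k = shift s`, and it equals `(±1)^n δ^(n)` at
`s = -(n+1)`. -/
def homPowDivGamma (σ : ℤˣ) (s : ℂ) : 𝓢'(ℝ, ℂ) :=
  (Complex.Gamma (s + (shift s : ℂ) + 1))⁻¹ • derivHalfPow σ s

/-! ### The boundary values `(ξ ∓ i0)^a` -/

/-- `T` is the limit of `(ξ ∓ iη)^a` (principal branch) as `η → 0+` in the sense of
distributions. -/
def IsBoundaryPow (σ : ℤˣ) (a : ℂ) (T : 𝓢'(ℝ, ℂ)) : Prop :=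
  ∀ φ : 𝓢(ℝ, ℂ),
    Tendsto (fun η : ℝ => ∫ ξ : ℝ, φ ξ * ((ξ : ℂ) - (sgn σ : ℂ) * Complex.I * (η : ℂ)) ^ a)
      (𝓝[>] 0) (𝓝 (T φ))

/-- The distribution `(ξ ∓ i0)^a`. (The limit is unique, and it always exists; the value in the
other case is irrelevant.) -/
def boundaryPow (σ : ℤˣ) (a : ℂ) : 𝓢'(ℝ, ℂ) :=
  open Classical in if h : ∃ T, IsBoundaryPow σ a T then h.choose else 0

/-! ### Cut-off functions and rapid decrease -/

/-- A cut-off function around zero: smooth, compactly supported and equal to `1` near zero. (That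
it be nonnegative and decreasing away from zero is not required here.) -/
structure IsCutoff (ω : ℝ → ℝ) : Prop where
  smooth : ContDiff ℝ ((⊤ : ℕ∞) : WithTop ℕ∞) ω
  compact : HasCompactSupport ω
  eq_one : ∀ᶠ x in 𝓝 0, ω x = 1

/-- Multiplication of a tempered distribution by a real function. -/
def mulFun (ω : ℝ → ℝ) (T : 𝓢'(ℝ, ℂ)) : 𝓢'(ℝ, ℂ) :=
  TemperedDistribution.smulLeftCLM ℂ (fun x => (ω x : ℂ)) T

/-- `f(x) = O([x]^{-∞})` as `|x| → ∞`, where `[x] = max 1 |x|`. -/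
def RapidlyDecreasing (f : ℝ → ℂ) : Prop :=
  ∀ N : ℕ, f =O[cocompact ℝ] fun x => ((max 1 |x|) ^ N)⁻¹

/-- `T` is given on the open set `U` by the function `f`: for test functions supported in `U`. -/
def IsGivenOn (T : 𝓢'(ℝ, ℂ)) (f : ℝ → ℂ) (U : Set ℝ) : Prop :=
  ∀ φ : 𝓢(ℝ, ℂ), tsupport φ ⊆ U →
    Integrable (fun x => φ x * f x) ∧ T φ = ∫ x, φ x * f x

/-- The constant `√(2π) / Γ(-a) · e^{∓ iπa/2}` (it is `0` at the poles of `Γ(-a)`). -/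
def homConst (σ : ℤˣ) (a : ℂ) : ℂ :=
  (Real.sqrt (2 * Real.pi) : ℂ) / Complex.Gamma (-a) *
    Complex.exp (-(sgn σ : ℂ) * Complex.I * Real.pi * a / 2)

end HomDist

end

noncomputable section

namespace HomDist

/-! For Re a < 0 the function x_±^{-a-1} is locally integrable. Its damping by e^{-η|x|} has, by a
Laplace integral, a Fourier transform proportional to Γ(-a) (ξ ∓ iη)^a. Fubini and η → 0
(`isBoundaryPow_of_re_neg`) give both the existence of (ξ ∓ i0)^a and its inverse transform. Larger
Re a are reached one unit at a time: multiplication by ξ raises a by one (`IsBoundaryPow.add_one`),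
it corresponds to -i d/dx under F⁻¹, and d/dx lowers s by one in the entire family x_±^s/Γ(s+1) up
to the factor ±1 (`invFourierD_boundaryPow`).

For a Schwartz function χ, F⁻¹[χ (ξ ∓ i0)^a] is the function `localPart`, a pairing with χ e^{ixξ}.
It is smooth because for Re a < 0 it is a correlation of x_±^{-a-1} with Fχ, and a factor ξ can
always be moved into χ to lower a.

Off the origin F⁻¹[(1-ω)(ξ ∓ i0)^a] is the difference `remainder` of the homogeneous function and
`localPart`. If Re a < -1, it is bounded, since (1-ω)|ξ|^{Re a} is integrable. The identity
`mul_remainder` converts a factor x into a lower exponent, plus a term with ω'; as ω' vanishes near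
0, that term decays rapidly by integration by parts. So any power of x times the remainder is
bounded for large |x|, which gives both asymptotic statements. -/

/-! ### The Laplace transform of a complex power -/

theorem integrableOn_rpow_mul_exp_neg {s c : ℝ} (hs : -1 < s) (hc : 0 < c) :
    IntegrableOn (fun t : ℝ => t ^ s * Real.exp (-(c * t))) (Set.Ioi 0) := by
  have := integrableOn_rpow_mul_exp_neg_mul_rpow (p := 1) (s := s) hs one_pos hc
  refine this.congr_fun (fun t _ => ?_) measurableSet_Ioi
  simp

theorem norm_cpow_mul_exp_neg (s r : ℂ) {t : ℝ} (ht : 0 < t) :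
    ‖(t : ℂ) ^ s * Complex.exp (-(r * t))‖ = t ^ s.re * Real.exp (-(r.re * t)) := by
  rw [norm_mul, Complex.norm_cpow_eq_rpow_re_of_pos ht, Complex.norm_exp]
  simp

theorem aestronglyMeasurable_cpow_mul_exp_neg (s r : ℂ) :
    AEStronglyMeasurable (fun t : ℝ => (t : ℂ) ^ s * Complex.exp (-(r * t)))
      (volume.restrict (Set.Ioi 0)) :=
  (Measurable.mul (by fun_prop) (by fun_prop)).aestronglyMeasurable

theorem integrableOn_cpow_mul_exp_neg {s r : ℂ} (hs : -1 < s.re) (hr : 0 < r.re) :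
    IntegrableOn (fun t : ℝ => (t : ℂ) ^ s * Complex.exp (-(r * t))) (Set.Ioi 0) := by
  refine (integrableOn_rpow_mul_exp_neg hs hr).mono'
    (aestronglyMeasurable_cpow_mul_exp_neg s r) ?_
  filter_upwards [ae_restrict_mem measurableSet_Ioi] with t ht
  exact (norm_cpow_mul_exp_neg s r ht).le

theorem differentiableAt_integral_cpow_mul_exp_neg {s r : ℂ} (hs : -1 < s.re) (hr : 0 < r.re) :
    DifferentiableAt ℂ
      (fun r : ℂ => ∫ t : ℝ in Set.Ioi 0, (t : ℂ) ^ s * Complex.exp (-(r * t))) r := by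
  -- On this half-plane the r-derivative of the integrand has an integrable majorant independent of
  -- z.
  have hU : {z : ℂ | r.re / 2 < z.re} ∈ 𝓝 r :=
    (isOpen_lt continuous_const Complex.continuous_re).mem_nhds (by simp; linarith)
  refine (hasDerivAt_integral_of_dominated_loc_of_deriv_le (μ := volume.restrict (Set.Ioi 0))
    (F := fun (r : ℂ) (t : ℝ) => (t : ℂ) ^ s * Complex.exp (-(r * t)))
    (F' := fun (r : ℂ) (t : ℝ) => (t : ℂ) ^ s * (Complex.exp (-(r * t)) * -(t : ℂ)))
    (bound := fun t => t ^ (s.re + 1) * Real.exp (-(r.re / 2 * t))) hU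
    (Eventually.of_forall fun z => aestronglyMeasurable_cpow_mul_exp_neg s z)
    (integrableOn_cpow_mul_exp_neg hs hr)
    (Measurable.mul (by fun_prop) (by fun_prop)).aestronglyMeasurable ?_
    (integrableOn_rpow_mul_exp_neg (by linarith) (by linarith)) ?_).2.differentiableAt
  · filter_upwards [ae_restrict_mem measurableSet_Ioi] with t ht z hz
    have ht' : 0 < t := ht
    have hz' : r.re / 2 < z.re := hz
    rw [← mul_assoc, norm_mul, norm_cpow_mul_exp_neg s z ht, norm_neg, Complex.norm_real,
      Real.norm_of_nonneg ht'.le, Real.rpow_add ht', Real.rpow_one, mul_right_comm]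
    gcongr
  · refine Eventually.of_forall fun t z _ => HasDerivAt.const_mul _ ?_
    have := ((hasDerivAt_id z).mul_const (t : ℂ)).neg.cexp
    simpa using this

/-- The Laplace transform of a complex power, at a complex argument. -/
theorem integral_cpow_mul_exp_neg_mul_Ioi_of_re_pos {a r : ℂ} (ha : 0 < a.re) (hr : 0 < r.re) :
    ∫ t : ℝ in Set.Ioi 0, (t : ℂ) ^ (a - 1) * Complex.exp (-(r * t)) =
      (1 / r) ^ a * Complex.Gamma a := by
  set U : Set ℂ := {z | 0 < z.re} with hU
  have hUo : IsOpen U := isOpen_lt continuous_const Complex.continuous_re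
  have h1 : AnalyticOnNhd ℂ
      (fun r : ℂ => ∫ t : ℝ in Set.Ioi 0, (t : ℂ) ^ (a - 1) * Complex.exp (-(r * t))) U :=
    DifferentiableOn.analyticOnNhd (fun z hz =>
      (differentiableAt_integral_cpow_mul_exp_neg (by simpa using ha) hz).differentiableWithinAt)
      hUo
  have h2 : AnalyticOnNhd ℂ (fun r : ℂ => (1 / r) ^ a * Complex.Gamma a) U := by
    refine DifferentiableOn.analyticOnNhd (fun z hz => ?_) hUo
    have hz' : 0 < z.re := hz
    have hz0 : z ≠ 0 := by
      rintro rfl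
      simp at hz'
    have hs : 1 / z ∈ Complex.slitPlane := by
      left
      rw [one_div, Complex.inv_re]
      exact div_pos hz' (Complex.normSq_pos.2 hz0)
    refine DifferentiableAt.differentiableWithinAt ?_
    refine DifferentiableAt.mul_const (DifferentiableAt.cpow_const ?_ hs) _
    exact (differentiableAt_const _).div differentiableAt_id hz0
  have hconn : IsPreconnected U := (convex_halfSpace_re_gt 0).isPreconnected
  refine h1.eqOn_of_preconnected_of_frequently_eq h2 hconn (z₀ := 1) (by simp [hU]) ?_ hr
  -- The formula is known for real r > 0; these real points accumulate at 1, as the identity theorem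
  -- requires.
  have ht : Tendsto (fun n : ℕ => (((1 + 1 / ((n : ℝ) + 1) : ℝ)) : ℂ)) atTop (𝓝[≠] 1) := by
    refine tendsto_nhdsWithin_iff.2 ⟨?_, Eventually.of_forall fun n => ?_⟩
    · have h := (tendsto_one_div_add_atTop_nhds_zero_nat (𝕜 := ℝ)).const_add 1
      rw [add_zero] at h
      exact_mod_cast (Complex.continuous_ofReal.tendsto 1).comp h
    · have : (0 : ℝ) < 1 / ((n : ℝ) + 1) := by positivity
      simp only [Set.mem_compl_iff, Set.mem_singleton_iff]
      exact_mod_cast (by linarith : (1 + 1 / ((n : ℝ) + 1) : ℝ) ≠ 1)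
  refine ht.frequently (Eventually.of_forall fun n => ?_).frequently
  have hp : (0 : ℝ) < 1 + 1 / ((n : ℝ) + 1) := by positivity
  exact Complex.integral_cpow_mul_exp_neg_mul_Ioi ha hp

/-! ### The points ξ ∓ iη and the transform of the damped power -/

theorem sgn_mul_self (σ : ℤˣ) : (sgn σ : ℂ) * sgn σ = 1 := by
  rcases Int.units_eq_one_or σ with rfl | rfl <;> simp [sgn]

theorem sgn_mul_self_real (σ : ℤˣ) : sgn σ * sgn σ = 1 := by
  rcases Int.units_eq_one_or σ with rfl | rfl <;> simp [sgn]

theorem sgn_ne_zero (σ : ℤˣ) : sgn σ ≠ 0 := fun h => by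
  simpa [h] using sgn_mul_self_real σ

/-- The point `ξ ∓ iη`. -/
def shiftedPt (σ : ℤˣ) (η ξ : ℝ) : ℂ := (ξ : ℂ) - (sgn σ : ℂ) * Complex.I * (η : ℂ)

theorem shiftedPt_im (σ : ℤˣ) (η ξ : ℝ) : (shiftedPt σ η ξ).im = -(sgn σ * η) := by
  simp [shiftedPt]

theorem shiftedPt_re (σ : ℤˣ) (η ξ : ℝ) : (shiftedPt σ η ξ).re = ξ := by
  simp [shiftedPt]

theorem shiftedPt_im_ne_zero (σ : ℤˣ) {η : ℝ} (hη : 0 < η) (ξ : ℝ) :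
    (shiftedPt σ η ξ).im ≠ 0 := by
  rw [shiftedPt_im]
  exact neg_ne_zero.2 (mul_ne_zero (sgn_ne_zero σ) hη.ne')

theorem shiftedPt_mem_slitPlane (σ : ℤˣ) {η : ℝ} (hη : 0 < η) (ξ : ℝ) :
    shiftedPt σ η ξ ∈ Complex.slitPlane :=
  Or.inr (shiftedPt_im_ne_zero σ hη ξ)

theorem shiftedPt_ne_zero (σ : ℤˣ) {η : ℝ} (hη : 0 < η) (ξ : ℝ) : shiftedPt σ η ξ ≠ 0 :=
  Complex.slitPlane_ne_zero (shiftedPt_mem_slitPlane σ hη ξ)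

/-- With w = η ± iξ one has ξ ∓ iη = ∓i w. Since |arg w| < π/2 and arg(∓i) = ∓π/2, the arguments add
up inside (-π, π), so the principal logarithm is additive and the only trace of the factor ∓i is the
phase. -/
theorem one_div_cpow_neg_eq (σ : ℤˣ) (a : ℂ) {η : ℝ} (hη : 0 < η) (ξ : ℝ) :
    (1 / ((η : ℂ) + Complex.I * sgn σ * ξ)) ^ (-a) =
      Complex.exp ((sgn σ : ℂ) * Complex.I * Real.pi * a / 2) * shiftedPt σ η ξ ^ a := by
  set w : ℂ := (η : ℂ) + Complex.I * sgn σ * ξ with hw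
  have hre : 0 < w.re := by simpa [hw] using hη
  have hw0 : w ≠ 0 := by
    intro h
    simp [h] at hre
  have harg : |w.arg| < Real.pi / 2 := Complex.abs_arg_lt_pi_div_two_iff.2 (Or.inl hre)
  rw [abs_lt] at harg
  have hz : shiftedPt σ η ξ = w * (-(sgn σ : ℂ) * Complex.I) := by
    rw [hw, shiftedPt]
    linear_combination ((sgn σ : ℂ) * sgn σ * ξ) * Complex.I_mul_I - (ξ : ℂ) * sgn_mul_self σ
  have hlog : Complex.log (shiftedPt σ η ξ) =
      Complex.log w - (sgn σ : ℂ) * Complex.I * Real.pi / 2 := by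
    rw [hz]
    rcases Int.units_eq_one_or σ with rfl | rfl
    · simp only [sgn, Units.val_one, Int.cast_one, Complex.ofReal_one, neg_mul, one_mul]
      rw [Complex.log_mul_eq_add_log_iff hw0 (by simp) |>.2, Complex.log_neg_I]
      · ring
      · rw [Complex.arg_neg_I]
        constructor <;> linarith
    · simp only [sgn, Units.val_neg, Units.val_one, Int.cast_neg, Int.cast_one,
        Complex.ofReal_neg, Complex.ofReal_one, neg_neg, neg_mul, one_mul]
      rw [Complex.log_mul_eq_add_log_iff hw0 (by simp) |>.2, Complex.log_I]
      · ring
      · rw [Complex.arg_I]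
        constructor <;> linarith
  rw [one_div, Complex.inv_cpow _ _ (by intro h; linarith [Real.pi_pos]), Complex.cpow_neg, inv_inv,
    Complex.cpow_def_of_ne_zero hw0, Complex.cpow_def_of_ne_zero (shiftedPt_ne_zero σ hη ξ),
    ← Complex.exp_add, hlog]
  congr 1
  ring

theorem halfPow_neg_one (s : ℂ) (x : ℝ) : halfPow (-1) s x = halfPow 1 s (-x) := by
  simp [halfPow, sgn]

theorem halfPow_one (s : ℂ) : halfPow 1 s = (Set.Ioi 0).indicator fun x : ℝ => (x : ℂ) ^ s := by
  funext x
  by_cases hx : 0 < x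
  · simp [halfPow, sgn, hx, abs_of_pos hx]
  · simp [halfPow, sgn, hx]

theorem measurable_halfPow (σ : ℤˣ) (s : ℂ) : Measurable (halfPow σ s) := by
  unfold halfPow
  exact Measurable.ite (measurableSet_lt measurable_const (by fun_prop)) (by fun_prop)
    measurable_const

theorem integrable_halfPow_mul_exp (σ : ℤˣ) {s : ℂ} (hs : -1 < s.re) {η : ℝ} (hη : 0 < η) :
    Integrable fun x : ℝ => halfPow σ s x * Real.exp (-(η * |x|)) := by
  have h1 : Integrable fun x : ℝ => halfPow 1 s x * Real.exp (-(η * |x|)) := by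
    have := integrableOn_cpow_mul_exp_neg (r := η) hs (by simpa using hη)
    rw [← integrable_indicator_iff measurableSet_Ioi] at this
    refine this.congr (Eventually.of_forall fun x => ?_)
    simp only [halfPow_one, Set.indicator_apply, Set.mem_Ioi]
    split_ifs with h
    · rw [abs_of_pos h]
      push_cast
      rfl
    · simp
  rcases Int.units_eq_one_or σ with rfl | rfl
  · exact h1
  · simpa [halfPow_neg_one] using h1.comp_neg

/-- The Fourier transform of `x_±^s e^{-η|x|}`. -/
theorem integral_halfPow_mul_exp (σ : ℤˣ) {a : ℂ} (ha : a.re < 0) {η : ℝ} (hη : 0 < η) (ξ : ℝ) :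
    ∫ x : ℝ, halfPow σ (-a - 1) x * Real.exp (-(η * |x|)) * Complex.exp (-Complex.I * ξ * x) =
      Complex.Gamma (-a) * (Complex.exp ((sgn σ : ℂ) * Complex.I * Real.pi * a / 2) *
        shiftedPt σ η ξ ^ a) := by
  have key : ∀ ζ : ℝ, ∫ x : ℝ, halfPow 1 (-a - 1) x * Real.exp (-(η * |x|)) *
      Complex.exp (-Complex.I * ζ * x) =
      (1 / ((η : ℂ) + Complex.I * ζ)) ^ (-a) * Complex.Gamma (-a) := by
    intro ζ
    rw [← integral_cpow_mul_exp_neg_mul_Ioi_of_re_pos (by simpa using ha) (by simpa using hη),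
      ← integral_indicator measurableSet_Ioi]
    refine integral_congr_ae (Eventually.of_forall fun x => ?_)
    simp only [halfPow_one, Set.indicator_apply, Set.mem_Ioi]
    split_ifs with h
    · rw [abs_of_pos h, mul_assoc]
      congr 1
      push_cast
      rw [← Complex.exp_add]
      congr 1
      ring
    · simp
  rw [← one_div_cpow_neg_eq σ a hη, mul_comm (Complex.Gamma _)]
  rcases Int.units_eq_one_or σ with rfl | rfl
  · simpa [sgn] using key ξ
  -- The lower sign is the upper one at -ξ, after the reflection x ↦ -x.
  · rw [← integral_neg_eq_self]
    simpa [sgn, halfPow_neg_one] using key (-ξ)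

/-! ### Operations on Schwartz functions -/

theorem hasTemperateGrowth_cexp_mul (c : ℝ) :
    Function.HasTemperateGrowth fun ξ : ℝ => Complex.exp (Complex.I * c * ξ) := by
  refine ⟨(contDiff_const.mul Complex.ofRealCLM.contDiff).cexp, fun n => ⟨0, |c| ^ n, fun x => ?_⟩⟩
  have hd : ∀ n : ℕ, iteratedDeriv n (fun ξ : ℝ => Complex.exp (Complex.I * c * ξ)) =
      fun ξ : ℝ => (Complex.I * c) ^ n * Complex.exp (Complex.I * c * ξ) := by
    intro n
    induction n with
    | zero => simp
    | succ n ih =>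
      rw [iteratedDeriv_succ, ih]
      funext ξ
      have := ((((hasDerivAt_id (ξ : ℂ)).const_mul (Complex.I * c)).cexp).const_mul
        ((Complex.I * c) ^ n)).comp_ofReal
      simp only [id] at this
      rw [this.deriv]
      ring
  rw [norm_iteratedFDeriv_eq_norm_iteratedDeriv, hd, norm_mul, norm_pow, norm_mul, Complex.norm_I,
    Complex.norm_real, one_mul, Real.norm_eq_abs, Complex.norm_exp]
  simp

/-- Multiplication by the variable. -/
def mulId : 𝓢(ℝ, ℂ) →L[ℂ] 𝓢(ℝ, ℂ) := SchwartzMap.smulLeftCLM ℂ fun ξ : ℝ => (ξ : ℂ)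

theorem mulId_apply (φ : 𝓢(ℝ, ℂ)) (ξ : ℝ) : mulId φ ξ = ξ * φ ξ := by
  rw [mulId, SchwartzMap.smulLeftCLM_apply_apply Function.Complex.hasTemperateGrowth_ofReal, smul_eq_mul]

/-- Multiplication by `e^{i x ξ}`. -/
def modulate (x : ℝ) : 𝓢(ℝ, ℂ) →L[ℂ] 𝓢(ℝ, ℂ) :=
  SchwartzMap.smulLeftCLM ℂ fun ξ : ℝ => Complex.exp (Complex.I * x * ξ)

theorem modulate_apply (x : ℝ) (φ : 𝓢(ℝ, ℂ)) (ξ : ℝ) :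
    modulate x φ ξ = Complex.exp (Complex.I * x * ξ) * φ ξ := by
  rw [modulate, SchwartzMap.smulLeftCLM_apply_apply (hasTemperateGrowth_cexp_mul x), smul_eq_mul]

theorem norm_cexp_I_mul (x ξ : ℝ) : ‖Complex.exp (Complex.I * x * ξ)‖ = 1 := by
  rw [Complex.norm_exp]
  simp

theorem norm_cexp_neg_I_mul (x ξ : ℝ) : ‖Complex.exp (-Complex.I * x * ξ)‖ = 1 := by
  rw [Complex.norm_exp]
  simp

theorem norm_modulate_apply (x : ℝ) (φ : 𝓢(ℝ, ℂ)) (ξ : ℝ) : ‖modulate x φ ξ‖ = ‖φ ξ‖ := by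
  rw [modulate_apply, norm_mul, norm_cexp_I_mul, one_mul]

theorem mulId_modulate (x : ℝ) (φ : 𝓢(ℝ, ℂ)) : mulId (modulate x φ) = modulate x (mulId φ) := by
  ext ξ
  simp only [mulId_apply, modulate_apply]
  ring

theorem derivCLM_modulate (x : ℝ) (φ : 𝓢(ℝ, ℂ)) :
    SchwartzMap.derivCLM ℂ ℂ (modulate x φ) =
      modulate x (SchwartzMap.derivCLM ℂ ℂ φ) + (Complex.I * x) • modulate x φ := by
  ext ξ
  have h1 : HasDerivAt (fun ξ : ℝ => Complex.exp (Complex.I * x * ξ))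
      (Complex.exp (Complex.I * x * ξ) * (Complex.I * x)) ξ := by
    have := (((hasDerivAt_id (ξ : ℂ)).const_mul (Complex.I * x)).cexp).comp_ofReal
    simpa using this
  have h2 := h1.mul (φ.hasDerivAt ξ)
  have h3 : (modulate x φ : ℝ → ℂ) = (fun ξ : ℝ => Complex.exp (Complex.I * x * ξ)) * φ := by
    funext ξ
    rw [modulate_apply]
    rfl
  rw [SchwartzMap.derivCLM_apply, h3, h2.deriv, add_apply, smul_apply,
    modulate_apply, modulate_apply, SchwartzMap.derivCLM_apply, smul_eq_mul]
  ring

/-! ### Fourier inversion and exchange formulas -/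

theorem sqrt_two_pi_ne_zero : (Real.sqrt (2 * Real.pi) : ℂ) ≠ 0 := by
  exact_mod_cast (Real.sqrt_pos.2 (by positivity)).ne'

theorem sqrt_two_pi_mul_self :
    (Real.sqrt (2 * Real.pi) : ℂ) * Real.sqrt (2 * Real.pi) = 2 * Real.pi := by
  exact_mod_cast Real.mul_self_sqrt (by positivity)

theorem invFourierS_eq (u : 𝓢(ℝ, ℂ)) (ξ : ℝ) :
    invFourierS u ξ = (Real.sqrt (2 * Real.pi) : ℂ)⁻¹ *
      (FourierTransformInv.fourierInv u) (ξ * (2 * Real.pi)⁻¹) := rfl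

/-- Inversion for the kernel e^{2πixξ} transfers by the substitution x = 2πy, whose Jacobian cancels
the two factors (2π)^{-1/2}. -/
theorem fourierS_invFourierS (φ : 𝓢(ℝ, ℂ)) : fourierS (invFourierS φ) = φ := by
  ext ξ
  have hpi : (2 * Real.pi) ≠ 0 := by positivity
  have h1 : φ ξ = ∫ y : ℝ, Complex.exp (-Complex.I * (2 * Real.pi * y : ℝ) * ξ) *
      (FourierTransformInv.fourierInv φ) y := by
    conv_lhs => rw [← FourierTransform.fourier_fourierInv_eq (F := 𝓢(ℝ, ℂ)) φ]
    rw [SchwartzMap.fourier_coe, Real.fourier_eq']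
    refine integral_congr_ae (Eventually.of_forall fun y => ?_)
    simp only [smul_eq_mul, RCLike.inner_apply, conj_trivial]
    congr 2
    push_cast
    ring
  have h2 := Measure.integral_comp_mul_left (fun x : ℝ => Complex.exp (-Complex.I * x * ξ) *
    (FourierTransformInv.fourierInv φ) (x * (2 * Real.pi)⁻¹)) (2 * Real.pi)
  rw [fourierS_apply]
  simp only [invFourierS_eq, mul_left_comm _ (Real.sqrt (2 * Real.pi) : ℂ)⁻¹]
  rw [integral_const_mul, ← mul_assoc, ← mul_inv, sqrt_two_pi_mul_self, h1]
  have h3 : ∀ x : ℝ, 2 * Real.pi * x * (2 * Real.pi)⁻¹ = x := fun x => by field_simp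
  simp only [h3] at h2
  rw [h2, abs_of_pos (by positivity), Complex.real_smul]
  push_cast
  rfl

theorem invFourierD_fourierD (T : 𝓢'(ℝ, ℂ)) : invFourierD (fourierD T) = T := by
  ext φ
  change T (fourierS (invFourierS φ)) = T φ
  rw [fourierS_invFourierS]

/-- The derivative of φ(ξ) e^{ixξ} has integral zero. -/
theorem invFourierS_derivCLM (φ : 𝓢(ℝ, ℂ)) :
    invFourierS (SchwartzMap.derivCLM ℂ ℂ φ) = -Complex.I • mulId (invFourierS φ) := by
  ext x
  have h0 : ∀ ψ : 𝓢(ℝ, ℂ), ∫ ξ : ℝ, SchwartzMap.derivCLM ℂ ℂ ψ ξ = 0 := fun ψ =>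
    integral_eq_zero_of_hasDerivAt_of_integrable (f := ψ) (fun ξ => ψ.hasDerivAt ξ)
      (SchwartzMap.derivCLM ℂ ℂ ψ).integrable ψ.integrable
  have h1 := h0 (modulate x φ)
  rw [derivCLM_modulate] at h1
  simp only [add_apply, smul_apply] at h1
  rw [integral_add (modulate x (SchwartzMap.derivCLM ℂ ℂ φ)).integrable
    (((modulate x φ).integrable (μ := volume)).fun_smul (Complex.I * (x : ℂ))),
    integral_smul] at h1
  simp only [modulate_apply, smul_eq_mul] at h1
  rw [invFourierS_apply, smul_apply, mulId_apply, invFourierS_apply, smul_eq_mul]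
  linear_combination (Real.sqrt (2 * Real.pi) : ℂ)⁻¹ * h1

theorem fourierS_modulate (x : ℝ) (χ : 𝓢(ℝ, ℂ)) (y : ℝ) :
    fourierS (modulate x χ) y = fourierS χ (y - x) := by
  simp only [fourierS_apply, modulate_apply]
  congr 1
  refine integral_congr_ae (Eventually.of_forall fun ξ => ?_)
  simp only
  rw [← mul_assoc, ← Complex.exp_add]
  congr 2
  push_cast
  ring

/-- The pointwise product of Schwartz functions. -/
def mulS (χ φ : 𝓢(ℝ, ℂ)) : 𝓢(ℝ, ℂ) := SchwartzMap.smulLeftCLM ℂ χ φ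

theorem mulS_apply (χ φ : 𝓢(ℝ, ℂ)) (ξ : ℝ) : mulS χ φ ξ = χ ξ * φ ξ := by
  rw [mulS, SchwartzMap.smulLeftCLM_apply_apply χ.hasTemperateGrowth, smul_eq_mul]

/-- The convolution theorem, by Fubini; it turns multiplication by a cut-off into a correlation with
its transform. -/
theorem fourierS_mulS_invFourierS (χ φ : 𝓢(ℝ, ℂ)) (y : ℝ) :
    fourierS (mulS χ (invFourierS φ)) y =
      (Real.sqrt (2 * Real.pi) : ℂ)⁻¹ * ∫ x : ℝ, fourierS χ (y - x) * φ x := by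
  have hint : Integrable (Function.uncurry fun ξ x : ℝ =>
      Complex.exp (-Complex.I * ξ * y) * Complex.exp (Complex.I * ξ * x) * (χ ξ * φ x))
      (volume.prod volume) := by
    refine (χ.integrable.mul_prod φ.integrable).bdd_mul (c := 1) ?_ ?_
    · exact Continuous.aestronglyMeasurable (by fun_prop)
    · refine Eventually.of_forall fun p => ?_
      rw [norm_mul, norm_cexp_I_mul, norm_cexp_neg_I_mul, one_mul]
  rw [fourierS_apply]
  simp only [mulS_apply, invFourierS_apply, fourierS_apply]
  congr 1
  calc ∫ ξ : ℝ, Complex.exp (-Complex.I * ξ * y) * (χ ξ * ((Real.sqrt (2 * Real.pi) : ℂ)⁻¹ *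
        ∫ x : ℝ, Complex.exp (Complex.I * ξ * x) * φ x))
      = ∫ ξ : ℝ, ∫ x : ℝ, (Real.sqrt (2 * Real.pi) : ℂ)⁻¹ * (Complex.exp (-Complex.I * ξ * y) *
        Complex.exp (Complex.I * ξ * x) * (χ ξ * φ x)) := by
        refine integral_congr_ae (Eventually.of_forall fun ξ => ?_)
        simp only
        rw [← integral_const_mul, ← integral_const_mul, ← integral_const_mul]
        refine integral_congr_ae (Eventually.of_forall fun x => ?_)
        simp only
        ring
    _ = ∫ x : ℝ, ∫ ξ : ℝ, (Real.sqrt (2 * Real.pi) : ℂ)⁻¹ * (Complex.exp (-Complex.I * ξ * y) *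
        Complex.exp (Complex.I * ξ * x) * (χ ξ * φ x)) :=
        integral_integral_swap (hint.const_mul _)
    _ = _ := by
        refine integral_congr_ae (Eventually.of_forall fun x => ?_)
        simp only
        rw [integral_const_mul, mul_assoc, ← integral_mul_const]
        congr 1
        refine integral_congr_ae (Eventually.of_forall fun ξ => ?_)
        simp only
        rw [← mul_assoc, ← Complex.exp_add]
        congr 3
        push_cast
        ring

/-! ### Bounds for `(ξ ∓ iη)^a` -/

theorem norm_cpow_le_rpow_mul_exp (z a : ℂ) :
    ‖z ^ a‖ ≤ ‖z‖ ^ a.re * Real.exp (Real.pi * |a.im|) := by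
  refine (Complex.norm_cpow_le z a).trans ?_
  rw [div_eq_mul_inv, ← Real.exp_neg]
  gcongr
  calc -(z.arg * a.im) ≤ |z.arg * a.im| := neg_le_abs _
    _ = |z.arg| * |a.im| := abs_mul _ _
    _ ≤ Real.pi * |a.im| := by
      gcongr
      exact Complex.abs_arg_le_pi z

/-- The upper bound on |z| serves for Re a ≥ 0 and the lower one for Re a ≤ 0; the constant covers
both cases. -/
theorem norm_cpow_le_of_bounds (a : ℂ) {z : ℂ} {ε R : ℝ} (hε : 0 < ε) (hR : 1 ≤ R)
    (h1 : ε ≤ ‖z‖) (h2 : ‖z‖ ≤ R) :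
    ‖z ^ a‖ ≤ (ε ^ a.re + 1) * Real.exp (Real.pi * |a.im|) * R ^ ⌈a.re⌉₊ := by
  refine (norm_cpow_le_rpow_mul_exp z a).trans ?_
  have hRk : 1 ≤ R ^ ⌈a.re⌉₊ := one_le_pow₀ hR
  have hp : 0 < ε ^ a.re := by positivity
  have : ‖z‖ ^ a.re ≤ (ε ^ a.re + 1) * R ^ ⌈a.re⌉₊ := by
    rcases le_total 0 a.re with h | h
    · have h3 : ‖z‖ ^ a.re ≤ R ^ ⌈a.re⌉₊ := by
        refine (Real.rpow_le_rpow (norm_nonneg _) h2 h).trans ?_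
        rw [← Real.rpow_natCast]
        exact Real.rpow_le_rpow_of_exponent_le hR (Nat.le_ceil _)
      nlinarith
    · have h3 : ‖z‖ ^ a.re ≤ ε ^ a.re := Real.rpow_le_rpow_of_nonpos hε h1 h
      nlinarith
  calc _ ≤ (ε ^ a.re + 1) * R ^ ⌈a.re⌉₊ * Real.exp (Real.pi * |a.im|) := by gcongr
    _ = _ := by ring

theorem abs_le_norm_shiftedPt (σ : ℤˣ) (η ξ : ℝ) : |ξ| ≤ ‖shiftedPt σ η ξ‖ := by
  simpa [shiftedPt_re] using Complex.abs_re_le_norm (shiftedPt σ η ξ)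

theorem abs_sgn (σ : ℤˣ) : |sgn σ| = 1 := by
  rcases Int.units_eq_one_or σ with rfl | rfl <;> simp [sgn]

theorem le_norm_shiftedPt (σ : ℤˣ) {η : ℝ} (hη : 0 < η) (ξ : ℝ) : η ≤ ‖shiftedPt σ η ξ‖ := by
  have := Complex.abs_im_le_norm (shiftedPt σ η ξ)
  rwa [shiftedPt_im, abs_neg, abs_mul, abs_sgn, one_mul, abs_of_pos hη] at this

theorem norm_shiftedPt_le (σ : ℤˣ) {η : ℝ} (hη : 0 < η) (hη1 : η ≤ 1) (ξ : ℝ) :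
    ‖shiftedPt σ η ξ‖ ≤ 1 + |ξ| := by
  have := Complex.norm_le_abs_re_add_abs_im (shiftedPt σ η ξ)
  rw [shiftedPt_im, shiftedPt_re, abs_neg, abs_mul, abs_sgn, one_mul, abs_of_pos hη] at this
  linarith

theorem continuous_shiftedPt_cpow (σ : ℤˣ) (a : ℂ) {η : ℝ} (hη : 0 < η) :
    Continuous fun ξ : ℝ => shiftedPt σ η ξ ^ a := by
  refine Continuous.cpow ?_ continuous_const fun ξ => shiftedPt_mem_slitPlane σ hη ξ
  unfold shiftedPt
  fun_prop

theorem integrable_pow_mul_schwartz (φ : 𝓢(ℝ, ℂ)) (k : ℕ) :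
    Integrable fun x : ℝ => (1 + |x|) ^ k * ‖φ x‖ := by
  have h : ∀ n : ℕ, Integrable fun x : ℝ => |x| ^ n * ‖φ x‖ := fun n => by
    simpa using φ.integrable_pow_mul volume n
  simp only [add_comm (1 : ℝ), add_pow, one_pow, mul_one, Finset.sum_mul]
  refine integrable_finsetSum _ fun n _ => ?_
  refine ((h n).const_mul (k.choose n : ℝ)).congr (Eventually.of_forall fun x => ?_)
  simp only
  ring

theorem integrable_mul_shiftedPt_cpow (σ : ℤˣ) (a : ℂ) {η : ℝ} (hη : 0 < η) (hη1 : η ≤ 1)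
    (φ : 𝓢(ℝ, ℂ)) : Integrable fun ξ : ℝ => φ ξ * shiftedPt σ η ξ ^ a := by
  refine ((integrable_pow_mul_schwartz φ ⌈a.re⌉₊).const_mul
    ((η ^ a.re + 1) * Real.exp (Real.pi * |a.im|))).mono'
    (φ.continuous.mul (continuous_shiftedPt_cpow σ a hη)).aestronglyMeasurable
    (Eventually.of_forall fun ξ => ?_)
  rw [norm_mul, mul_comm, ← mul_assoc]
  gcongr
  exact norm_cpow_le_of_bounds a hη (by linarith [abs_nonneg ξ]) (le_norm_shiftedPt σ hη ξ)
    (norm_shiftedPt_le σ hη hη1 ξ)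

theorem eventually_small : ∀ᶠ η : ℝ in 𝓝[>] 0, 0 < η ∧ η ≤ 1 := by
  filter_upwards [Ioc_mem_nhdsGT (zero_lt_one (α := ℝ))] with η hη
  exact hη

theorem IsBoundaryPow.tendsto {σ : ℤˣ} {a : ℂ} {T : 𝓢'(ℝ, ℂ)} (hT : IsBoundaryPow σ a T)
    (φ : 𝓢(ℝ, ℂ)) :
    Tendsto (fun η : ℝ => ∫ ξ : ℝ, φ ξ * shiftedPt σ η ξ ^ a) (𝓝[>] 0) (𝓝 (T φ)) := hT φ

/-! ### Shifting the exponent, and differentiation -/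

/-- With z = ξ ∓ iη, z^{a+1} = ξ z^a ∓ iη z^a, and the last term disappears in the limit because ∫ φ
z^a converges. -/
theorem IsBoundaryPow.add_one {σ : ℤˣ} {a : ℂ} {T : 𝓢'(ℝ, ℂ)} (hT : IsBoundaryPow σ a T) :
    IsBoundaryPow σ (a + 1) (PointwiseConvergenceCLM.precomp ℂ mulId T) := by
  intro φ
  change Tendsto (fun η : ℝ => ∫ ξ : ℝ, φ ξ * shiftedPt σ η ξ ^ (a + 1)) _ (𝓝 (T (mulId φ)))
  have h1 := hT.tendsto (mulId φ)
  have h2 : Tendsto (fun η : ℝ => (sgn σ : ℂ) * Complex.I * (η : ℂ)) (𝓝[>] 0) (𝓝 0) := by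
    have : Tendsto (fun η : ℝ => (sgn σ : ℂ) * Complex.I * (η : ℂ)) (𝓝 0)
        (𝓝 ((sgn σ : ℂ) * Complex.I * ((0 : ℝ) : ℂ))) :=
      Continuous.tendsto (by fun_prop) 0
    simp only [Complex.ofReal_zero, mul_zero] at this
    exact this.mono_left nhdsWithin_le_nhds
  have h3 := h1.sub (h2.mul (hT.tendsto φ))
  rw [zero_mul, sub_zero] at h3
  refine h3.congr' ?_
  filter_upwards [eventually_small] with η hη
  rw [← integral_const_mul, ← integral_sub (integrable_mul_shiftedPt_cpow σ a hη.1 hη.2 _)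
    ((integrable_mul_shiftedPt_cpow σ a hη.1 hη.2 _).const_mul _)]
  refine integral_congr_ae (Eventually.of_forall fun ξ => ?_)
  simp only
  rw [mulId_apply, Complex.cpow_add _ _ (shiftedPt_ne_zero σ hη.1 ξ), Complex.cpow_one]
  have : shiftedPt σ η ξ = (ξ : ℂ) - (sgn σ : ℂ) * Complex.I * (η : ℂ) := rfl
  linear_combination -(φ ξ * shiftedPt σ η ξ ^ a) * this

theorem integral_deriv_mul_shiftedPt_cpow (σ : ℤˣ) (a : ℂ) {η : ℝ} (hη : 0 < η) (hη1 : η ≤ 1)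
    (φ : 𝓢(ℝ, ℂ)) :
    ∫ ξ : ℝ, SchwartzMap.derivCLM ℂ ℂ φ ξ * shiftedPt σ η ξ ^ a =
      -(a * ∫ ξ : ℝ, φ ξ * shiftedPt σ η ξ ^ (a - 1)) := by
  have hd : ∀ ξ : ℝ, HasDerivAt (fun ξ : ℝ => φ ξ * shiftedPt σ η ξ ^ a)
      (SchwartzMap.derivCLM ℂ ℂ φ ξ * shiftedPt σ η ξ ^ a +
        a * (φ ξ * shiftedPt σ η ξ ^ (a - 1))) ξ := by
    intro ξ
    have h1 : HasDerivAt (fun ξ : ℝ => shiftedPt σ η ξ) 1 ξ := by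
      have := ((hasDerivAt_id (ξ : ℂ)).sub_const ((sgn σ : ℂ) * Complex.I * (η : ℂ))).comp_ofReal
      exact this
    have h2 := HasDerivAt.comp_of_eq (h₂ := fun z : ℂ => z ^ a) ξ
      ((hasDerivAt_id _).cpow_const (c := a) (shiftedPt_mem_slitPlane σ hη ξ)) h1 rfl
    have h3 := (φ.hasDerivAt ξ).mul h2
    refine h3.congr_deriv ?_
    simp only [SchwartzMap.derivCLM_apply, Function.comp, id, shiftedPt]
    ring
  have hi1 := integrable_mul_shiftedPt_cpow σ a hη hη1 (SchwartzMap.derivCLM ℂ ℂ φ)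
  have hi2 := (integrable_mul_shiftedPt_cpow σ (a - 1) hη hη1 φ).const_mul a
  have := integral_eq_zero_of_hasDerivAt_of_integrable hd (hi1.add hi2)
    (integrable_mul_shiftedPt_cpow σ a hη hη1 φ)
  rw [integral_add hi1 hi2, integral_const_mul] at this
  exact eq_neg_of_add_eq_zero_left this

theorem IsBoundaryPow.apply_derivCLM {σ : ℤˣ} {a : ℂ} {T S : 𝓢'(ℝ, ℂ)} (hT : IsBoundaryPow σ a T)
    (hS : IsBoundaryPow σ (a - 1) S) (φ : 𝓢(ℝ, ℂ)) :
    T (SchwartzMap.derivCLM ℂ ℂ φ) = -(a * S φ) := by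
  refine tendsto_nhds_unique (hT.tendsto _) (((hS.tendsto φ).const_mul a).neg.congr' ?_)
  filter_upwards [eventually_small] with η hη
  exact (integral_deriv_mul_shiftedPt_cpow σ a hη.1 hη.2 φ).symm

theorem IsBoundaryPow.unique {σ : ℤˣ} {a : ℂ} {T S : 𝓢'(ℝ, ℂ)} (hT : IsBoundaryPow σ a T)
    (hS : IsBoundaryPow σ a S) : T = S := by
  ext φ
  exact tendsto_nhds_unique (hT φ) (hS φ)

/-- Majorants uniform in 0 < η ≤ 1 survive the limit; this is how the distribution is estimated
below. -/
theorem IsBoundaryPow.norm_apply_le {σ : ℤˣ} {a : ℂ} {T : 𝓢'(ℝ, ℂ)} (hT : IsBoundaryPow σ a T)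
    (φ : 𝓢(ℝ, ℂ)) {B : ℝ → ℝ} (hB : Integrable B)
    (h : ∀ ξ η : ℝ, 0 < η → η ≤ 1 → ‖φ ξ‖ * ‖shiftedPt σ η ξ ^ a‖ ≤ B ξ) :
    ‖T φ‖ ≤ ∫ ξ, B ξ := by
  refine le_of_tendsto (hT.tendsto φ).norm ?_
  filter_upwards [eventually_small] with η hη
  refine norm_integral_le_of_norm_le hB (Eventually.of_forall fun ξ => ?_)
  rw [norm_mul]
  exact h ξ η hη.1 hη.2

/-! ### The case `Re a < 0` -/

theorem homPowDivGamma_apply_of_re (σ : ℤˣ) {s : ℂ} (hs : -1 < s.re) (φ : 𝓢(ℝ, ℂ)) :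
    homPowDivGamma σ s φ = (Complex.Gamma (s + 1))⁻¹ * ∫ x, φ x * halfPow σ s x := by
  have h0 : shift s = 0 := by
    rw [shift, Nat.floor_eq_zero]
    linarith
  have h1 : homPowDivGamma σ s φ = (Complex.Gamma (s + (shift s : ℂ) + 1))⁻¹ *
      ((sgn σ : ℂ) ^ shift s *
        (iterDeriv (shift s) (ofFun _ (halfPow_polyIntegrable σ (shift_spec s)))) φ) := rfl
  rw [h1]
  -- The integrability proof depends on `shift s`, so it is abstracted before `shift s` is replaced
  -- by 0.
  generalize_proofs pf
  revert pf
  rw [h0]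
  intro pf
  simp only [Nat.cast_zero, add_zero, pow_zero, one_mul]
  congr 1

/-- The phase `√(2π) e^{∓ iπa/2}`. -/
def phase (σ : ℤˣ) (a : ℂ) : ℂ :=
  (Real.sqrt (2 * Real.pi) : ℂ) * Complex.exp (-(sgn σ : ℂ) * Complex.I * Real.pi * a / 2)

/-- The damping makes the double integral absolutely convergent, so Fubini moves the Fourier
transform from φ to the damped power. -/
theorem integral_schwartz_mul_shiftedPt_cpow (σ : ℤˣ) {a : ℂ} (ha : a.re < 0) {η : ℝ} (hη : 0 < η)
    (φ : 𝓢(ℝ, ℂ)) :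
    phase σ a * ((Complex.Gamma (-a))⁻¹ *
      ∫ x : ℝ, fourierS φ x * (halfPow σ (-a - 1) x * Real.exp (-(η * |x|)))) =
      ∫ ξ : ℝ, φ ξ * shiftedPt σ η ξ ^ a := by
  have hΓ : Complex.Gamma (-a) ≠ 0 := by
    refine Complex.Gamma_ne_zero fun m h => ?_
    have := congrArg Complex.re h
    simp only [Complex.neg_re, Complex.natCast_re] at this
    have hm : (0 : ℝ) ≤ m := Nat.cast_nonneg m
    linarith
  have hh := integrable_halfPow_mul_exp σ (s := -a - 1) (by simpa using ha) hη
  have hint : Integrable (Function.uncurry fun x ξ : ℝ => Complex.exp (-Complex.I * ξ * x) *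
      ((halfPow σ (-a - 1) x * Real.exp (-(η * |x|))) * φ ξ)) (volume.prod volume) := by
    refine (hh.mul_prod φ.integrable).bdd_mul (c := 1) ?_ ?_
    · exact Continuous.aestronglyMeasurable (by fun_prop)
    · exact Eventually.of_forall fun p => (norm_cexp_neg_I_mul _ _).le
  have hexp : Complex.exp (-(sgn σ : ℂ) * Complex.I * Real.pi * a / 2) *
      Complex.exp ((sgn σ : ℂ) * Complex.I * Real.pi * a / 2) = 1 := by
    rw [← Complex.exp_add, ← Complex.exp_zero]
    congr 1
    ring
  have h1 : ∫ x : ℝ, fourierS φ x * (halfPow σ (-a - 1) x * Real.exp (-(η * |x|))) =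
      (Real.sqrt (2 * Real.pi) : ℂ)⁻¹ * (Complex.Gamma (-a) *
        Complex.exp ((sgn σ : ℂ) * Complex.I * Real.pi * a / 2) *
          ∫ ξ : ℝ, φ ξ * shiftedPt σ η ξ ^ a) := by
    calc _ = ∫ x : ℝ, ∫ ξ : ℝ, (Real.sqrt (2 * Real.pi) : ℂ)⁻¹ *
          (Complex.exp (-Complex.I * ξ * x) *
          ((halfPow σ (-a - 1) x * Real.exp (-(η * |x|))) * φ ξ)) := by
          refine integral_congr_ae (Eventually.of_forall fun x => ?_)
          simp only
          rw [fourierS_apply, integral_const_mul, mul_assoc, ← integral_mul_const]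
          congr 1
          refine integral_congr_ae (Eventually.of_forall fun ξ => ?_)
          simp only
          ring
      _ = ∫ ξ : ℝ, ∫ x : ℝ, (Real.sqrt (2 * Real.pi) : ℂ)⁻¹ *
          (Complex.exp (-Complex.I * ξ * x) *
          ((halfPow σ (-a - 1) x * Real.exp (-(η * |x|))) * φ ξ)) :=
          integral_integral_swap (hint.const_mul _)
      _ = _ := by
          rw [← integral_const_mul, ← integral_const_mul]
          refine integral_congr_ae (Eventually.of_forall fun ξ => ?_)
          simp only
          rw [integral_const_mul]
          congr 1
          have := integral_halfPow_mul_exp σ ha hη ξ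
          rw [mul_mul_mul_comm, mul_comm (Complex.Gamma (-a)) (φ ξ), mul_assoc, ← this,
            ← integral_const_mul]
          refine integral_congr_ae (Eventually.of_forall fun x => ?_)
          simp only
          ring
  rw [h1, phase]
  have h2 := mul_inv_cancel₀ hΓ
  have h3 := mul_inv_cancel₀ sqrt_two_pi_ne_zero
  set J := ∫ ξ : ℝ, φ ξ * shiftedPt σ η ξ ^ a
  set E1 := Complex.exp (-(sgn σ : ℂ) * Complex.I * Real.pi * a / 2)
  set E2 := Complex.exp ((sgn σ : ℂ) * Complex.I * Real.pi * a / 2)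
  calc _ = ((Real.sqrt (2 * Real.pi) : ℂ) * (Real.sqrt (2 * Real.pi) : ℂ)⁻¹) * (E1 * E2) *
        (Complex.Gamma (-a) * (Complex.Gamma (-a))⁻¹) * J := by ring
    _ = J := by rw [h2, h3, hexp]; ring

theorem isBoundaryPow_of_re_neg (σ : ℤˣ) {a : ℂ} (ha : a.re < 0) :
    IsBoundaryPow σ a (phase σ a • fourierD (homPowDivGamma σ (-a - 1))) := by
  intro φ
  have hs : -1 < (-a - 1).re := by simpa using ha
  change Tendsto (fun η : ℝ => ∫ ξ : ℝ, φ ξ * shiftedPt σ η ξ ^ a) (𝓝[>] 0)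
    (𝓝 (phase σ a * homPowDivGamma σ (-a - 1) (fourierS φ)))
  rw [homPowDivGamma_apply_of_re σ hs, sub_add_cancel]
  obtain ⟨_, _, _, hi⟩ := (halfPow_polyIntegrable σ hs).exists_bound
  have hlim : Tendsto (fun η : ℝ => ∫ x : ℝ, fourierS φ x *
      (halfPow σ (-a - 1) x * Real.exp (-(η * |x|)))) (𝓝[>] 0)
      (𝓝 (∫ x, fourierS φ x * halfPow σ (-a - 1) x)) := by
    -- The undamped integrand is the majorant, since e^{-η|x|} ≤ 1.
    refine tendsto_integral_filter_of_dominated_convergence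
      (fun x => ‖fourierS φ x * halfPow σ (-a - 1) x‖) ?_ ?_ (hi (fourierS φ)).1.norm ?_
    · refine Eventually.of_forall fun η => ?_
      exact (fourierS φ).continuous.aestronglyMeasurable.mul
        (((measurable_halfPow σ _).mul (by fun_prop)).aestronglyMeasurable)
    · filter_upwards [eventually_small] with η hη
      refine Eventually.of_forall fun x => ?_
      rw [← mul_assoc, norm_mul _ ((Real.exp _ : ℝ) : ℂ), Complex.norm_real,
        Real.norm_of_nonneg (Real.exp_nonneg _)]
      refine mul_le_of_le_one_right (norm_nonneg _) (Real.exp_le_one_iff.2 ?_)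
      have := mul_nonneg hη.1.le (abs_nonneg x)
      linarith
    · refine Eventually.of_forall fun x => ?_
      have : Tendsto (fun η : ℝ => fourierS φ x *
          (halfPow σ (-a - 1) x * Real.exp (-(η * |x|)))) (𝓝 0) (𝓝 (fourierS φ x *
          (halfPow σ (-a - 1) x * Real.exp (-(0 * |x|))))) :=
        Continuous.tendsto (by fun_prop) 0
      simp only [zero_mul, neg_zero, Real.exp_zero, Complex.ofReal_one, mul_one] at this
      exact this.mono_left nhdsWithin_le_nhds
  refine ((hlim.const_mul _).const_mul _).congr' ?_
  filter_upwards [eventually_small] with η hη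
  exact integral_schwartz_mul_shiftedPt_cpow σ ha hη.1 φ

/-! ### Existence of `(ξ ∓ i0)^a` and its inverse Fourier transform -/

theorem exists_isBoundaryPow (σ : ℤˣ) (a : ℂ) : ∃ T, IsBoundaryPow σ a T := by
  obtain ⟨n, hn⟩ := exists_nat_gt a.re
  induction n generalizing a with
  | zero => exact ⟨_, isBoundaryPow_of_re_neg σ (by simpa using hn)⟩
  | succ n ih =>
    obtain ⟨T, hT⟩ := ih (a - 1) (by
      push_cast at hn
      simp only [Complex.sub_re, Complex.one_re]
      linarith)
    exact ⟨_, by simpa using hT.add_one⟩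

theorem isBoundaryPow_boundaryPow (σ : ℤˣ) (a : ℂ) : IsBoundaryPow σ a (boundaryPow σ a) := by
  have h := exists_isBoundaryPow σ a
  rw [boundaryPow, dif_pos h]
  exact h.choose_spec

theorem IsBoundaryPow.eq_boundaryPow {σ : ℤˣ} {a : ℂ} {T : 𝓢'(ℝ, ℂ)} (hT : IsBoundaryPow σ a T) :
    boundaryPow σ a = T :=
  (isBoundaryPow_boundaryPow σ a).unique hT

theorem boundaryPow_add_one_apply (σ : ℤˣ) (a : ℂ) (φ : 𝓢(ℝ, ℂ)) :
    boundaryPow σ (a + 1) φ = boundaryPow σ a (mulId φ) := by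
  rw [(isBoundaryPow_boundaryPow σ a).add_one.eq_boundaryPow]
  rfl

theorem boundaryPow_apply_derivCLM (σ : ℤˣ) (a : ℂ) (φ : 𝓢(ℝ, ℂ)) :
    boundaryPow σ a (SchwartzMap.derivCLM ℂ ℂ φ) = -(a * boundaryPow σ (a - 1) φ) :=
  (isBoundaryPow_boundaryPow σ a).apply_derivCLM (isBoundaryPow_boundaryPow σ (a - 1)) φ

theorem derivCLM_invFourierD_boundaryPow (σ : ℤˣ) (a : ℂ) :
    TemperedDistribution.derivCLM ℂ (invFourierD (boundaryPow σ a)) =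
      Complex.I • invFourierD (boundaryPow σ (a + 1)) := by
  ext φ
  change boundaryPow σ a (invFourierS (-SchwartzMap.derivCLM ℂ ℂ φ)) =
    Complex.I * boundaryPow σ (a + 1) (invFourierS φ)
  rw [boundaryPow_add_one_apply, map_neg, invFourierS_derivCLM, neg_smul, neg_neg, map_smul,
    smul_eq_mul]

/-- The natural-number floor truncates at 0, hence the restriction on Re s: for 0 < Re s < 1 both
shifts are 0. -/
theorem shift_sub_one {s : ℂ} (hs : s.re ≤ 0) : shift (s - 1) = shift s + 1 := by
  rw [shift, shift, ← Nat.floor_add_one (by linarith)]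
  congr 1
  simp
  ring

/-- Passing from s to s - 1 raises k by one and leaves s + k unchanged: same function, same Gamma
factor, one more derivative and one more sign. -/
theorem derivCLM_homPowDivGamma (σ : ℤˣ) {s : ℂ} (hs : s.re ≤ 0) :
    TemperedDistribution.derivCLM ℂ (homPowDivGamma σ s) =
      (sgn σ : ℂ) • homPowDivGamma σ (s - 1) := by
  have key : ∀ (k : ℕ) (s' : ℂ) (p : -1 < s'.re), s' = s + (shift s : ℂ) → k = shift s + 1 →
      TemperedDistribution.derivCLM ℂ (homPowDivGamma σ s) =
      (sgn σ : ℂ) • (Complex.Gamma (s' + 1))⁻¹ •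
        (((sgn σ : ℂ) ^ k) • iterDeriv k (ofFun _ (halfPow_polyIntegrable σ p))) := by
    rintro _ _ p rfl rfl
    rw [homPowDivGamma, derivHalfPow, map_smul, map_smul, iterDeriv, iterDeriv,
      Function.iterate_succ_apply', smul_comm (sgn σ : ℂ), smul_smul (sgn σ : ℂ), pow_succ',
      ← mul_assoc, sgn_mul_self, one_mul]
  have hk := shift_sub_one hs
  refine key (shift (s - 1)) (s - 1 + (shift (s - 1) : ℂ)) (shift_spec _) ?_ hk
  rw [hk]
  push_cast
  ring

theorem phase_add_one (σ : ℤˣ) (a : ℂ) : phase σ (a + 1) = -Complex.I * sgn σ * phase σ a := by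
  have : -(sgn σ : ℂ) * Complex.I * Real.pi * (a + 1) / 2 =
      -(sgn σ : ℂ) * Complex.I * Real.pi * a / 2 + sgn σ * (-(Real.pi / 2 * Complex.I)) := by ring
  rw [phase, phase, this, Complex.exp_add]
  have h2 : Complex.exp (sgn σ * (-(Real.pi / 2 * Complex.I))) = -Complex.I * sgn σ := by
    rcases Int.units_eq_one_or σ with rfl | rfl
    · simp [sgn, Complex.exp_neg, Complex.exp_pi_div_two_mul_I]
    · simp [sgn, Complex.exp_pi_div_two_mul_I]
  rw [h2]
  ring

theorem invFourierD_boundaryPow (σ : ℤˣ) (a : ℂ) :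
    invFourierD (boundaryPow σ a) = phase σ a • homPowDivGamma σ (-a - 1) := by
  obtain ⟨n, hn⟩ := exists_nat_gt a.re
  induction n generalizing a with
  | zero =>
    rw [(isBoundaryPow_of_re_neg σ (by simpa using hn)).eq_boundaryPow, map_smul,
      invFourierD_fourierD]
  | succ n ih =>
    by_cases h0 : a.re < 0
    · rw [(isBoundaryPow_of_re_neg σ h0).eq_boundaryPow, map_smul, invFourierD_fourierD]
    · push_cast at hn
      have h1 := ih (a - 1) (by
        simp only [Complex.sub_re, Complex.one_re]
        linarith)
      -- Differentiating the formula for a - 1 gives the one for a; the family is differentiated at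
      -- s = -a, where Re s ≤ 0.
      have h2 := derivCLM_invFourierD_boundaryPow σ (a - 1)
      have h3 : -(a - 1) - 1 = -a := by ring
      have h4 := phase_add_one σ (a - 1)
      rw [sub_add_cancel] at h2 h4
      rw [h1, h3, map_smul, derivCLM_homPowDivGamma σ (by simp; linarith)] at h2
      have h5 : invFourierD (boundaryPow σ a) =
          -Complex.I • Complex.I • invFourierD (boundaryPow σ a) := by
        rw [smul_smul]
        simp
      rw [h5, ← h2, h4, smul_smul, smul_smul]
      congr 1
      ring

theorem homConst_eq (σ : ℤˣ) (a : ℂ) : homConst σ a = phase σ a * (Complex.Gamma (-a))⁻¹ := by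
  rw [homConst, phase]
  ring

theorem Gamma_add_natCast (s : ℂ) (hs : ∀ n : ℕ, s ≠ -((n : ℂ) + 1)) (k : ℕ) :
    Complex.Gamma (s + k + 1) =
      (∏ j ∈ Finset.range k, (s + (j : ℂ) + 1)) * Complex.Gamma (s + 1) := by
  induction k with
  | zero => simp
  | succ k ih =>
    have hk : s + k + 1 ≠ 0 := fun h => hs k (by linear_combination h)
    rw [Finset.prod_range_succ, mul_right_comm, ← ih, mul_comm, ← Complex.Gamma_add_one _ hk]
    congr 1
    push_cast
    ring

theorem homPowDivGamma_eq_smul_homPow (σ : ℤˣ) {s : ℂ} (hs : ∀ n : ℕ, s ≠ -((n : ℂ) + 1)) :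
    homPowDivGamma σ s = (Complex.Gamma (s + 1))⁻¹ • homPow σ s := by
  rw [homPowDivGamma, homPow, if_neg (not_exists.2 hs), smul_smul, Gamma_add_natCast s hs, mul_inv,
    mul_comm]

theorem invFourierD_boundaryPow_eq_homPow (σ : ℤˣ) {a : ℂ} (ha : ∀ n : ℕ, a ≠ n) :
    invFourierD (boundaryPow σ a) = homConst σ a • homPow σ (-a - 1) := by
  rw [invFourierD_boundaryPow, homPowDivGamma_eq_smul_homPow σ, smul_smul, homConst_eq,
    sub_add_cancel]
  intro n h
  exact ha n (by linear_combination -h)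

/-! ### Correlation of a polynomially integrable function with a Schwartz function -/

theorem exists_translate_bound (κ : 𝓢(ℝ, ℂ)) (k : ℕ) :
    ∃ C : ℝ, 0 ≤ C ∧ ∀ x y : ℝ, ‖κ (y - x)‖ ≤ C * (1 + |x|) ^ k * ((1 + |y|) ^ k)⁻¹ := by
  refine ⟨2 ^ k * ((Finset.Iic (k, 0)).sup (schwartzSeminormFamily ℂ ℝ ℂ)) κ,
    mul_nonneg (by positivity) (apply_nonneg _ _), fun x y => ?_⟩
  have h := SchwartzMap.one_add_le_sup_seminorm_apply (𝕜 := ℂ) (m := (k, 0)) le_rfl le_rfl κ (y - x)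
  rw [norm_iteratedFDeriv_zero, Real.norm_eq_abs] at h
  -- Peetre's inequality.
  have h1 : 1 + |y| ≤ (1 + |y - x|) * (1 + |x|) := by
    have := abs_add_le (y - x) x
    rw [sub_add_cancel] at this
    nlinarith [abs_nonneg x, abs_nonneg (y - x), mul_nonneg (abs_nonneg x) (abs_nonneg (y - x))]
  have h2 : (1 + |y|) ^ k ≤ (1 + |y - x|) ^ k * (1 + |x|) ^ k := by
    rw [← mul_pow]
    gcongr
  rw [← div_eq_mul_inv, le_div_iff₀ (by positivity)]
  calc ‖κ (y - x)‖ * (1 + |y|) ^ k ≤ ‖κ (y - x)‖ * ((1 + |y - x|) ^ k * (1 + |x|) ^ k) := by gcongr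
    _ = ((1 + |y - x|) ^ k * ‖κ (y - x)‖) * (1 + |x|) ^ k := by ring
    _ ≤ _ := mul_le_mul_of_nonneg_right h (by positivity)

/-- The function `x ↦ ∫ κ(y - x) h(y) dy`. -/
def correlation (h : ℝ → ℂ) (κ : 𝓢(ℝ, ℂ)) (x : ℝ) : ℂ := ∫ y, κ (y - x) * h y

theorem PolyIntegrable.aestronglyMeasurable {h : ℝ → ℂ} (hh : PolyIntegrable h) :
    AEStronglyMeasurable h := by
  obtain ⟨k, hk⟩ := hh
  have h1 : AEStronglyMeasurable (fun x : ℝ => (((1 + |x|) ^ k : ℝ) : ℂ)) volume :=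
    (Complex.continuous_ofReal.comp (by fun_prop)).aestronglyMeasurable
  refine (h1.mul hk.aestronglyMeasurable).congr (Eventually.of_forall fun x => ?_)
  have : (((1 + |x|) ^ k : ℝ) : ℂ) ≠ 0 := by
    exact_mod_cast (by positivity : (1 + |x|) ^ k ≠ 0)
  rw [Pi.mul_apply, Complex.ofReal_inv, mul_inv_cancel_left₀ this]

theorem PolyIntegrable.norm_integrable {h : ℝ → ℂ} (hh : PolyIntegrable h) :
    ∃ k : ℕ, Integrable fun x : ℝ => ((1 + |x|) ^ k)⁻¹ * ‖h x‖ := by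
  obtain ⟨k, hk⟩ := hh
  refine ⟨k, hk.norm.congr (Eventually.of_forall fun x => ?_)⟩
  simp only
  rw [norm_mul, Complex.norm_real, Real.norm_of_nonneg (by positivity)]

theorem aestronglyMeasurable_translate_mul {h : ℝ → ℂ} (hh : PolyIntegrable h) (κ : 𝓢(ℝ, ℂ))
    (x : ℝ) : AEStronglyMeasurable fun y => κ (y - x) * h y :=
  (κ.continuous.comp (continuous_id.sub continuous_const)).aestronglyMeasurable.mul
    hh.aestronglyMeasurable

theorem integrable_translate_mul {h : ℝ → ℂ} (hh : PolyIntegrable h) (κ : 𝓢(ℝ, ℂ)) (x : ℝ) :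
    Integrable fun y => κ (y - x) * h y := by
  obtain ⟨k, hk⟩ := hh.norm_integrable
  obtain ⟨C, hC, hb⟩ := exists_translate_bound κ k
  refine (hk.const_mul (C * (1 + |x|) ^ k)).mono' (aestronglyMeasurable_translate_mul hh κ x)
    (Eventually.of_forall fun y => ?_)
  rw [norm_mul, ← mul_assoc]
  gcongr
  exact hb x y

theorem hasDerivAt_correlation {h : ℝ → ℂ} (hh : PolyIntegrable h) (κ : 𝓢(ℝ, ℂ)) (x : ℝ) :
    HasDerivAt (correlation h κ) (-correlation h (SchwartzMap.derivCLM ℂ ℂ κ) x) x := by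
  obtain ⟨k, hk⟩ := hh.norm_integrable
  obtain ⟨C, hC, hb⟩ := exists_translate_bound (SchwartzMap.derivCLM ℂ ℂ κ) k
  have := (hasDerivAt_integral_of_dominated_loc_of_deriv_le (μ := volume) (x₀ := x)
    (F := fun x y => κ (y - x) * h y)
    (F' := fun x y => -(SchwartzMap.derivCLM ℂ ℂ κ (y - x) * h y))
    -- On the unit ball around x one has 1 + |z| ≤ 2 + |x|.
    (bound := fun y => C * (2 + |x|) ^ k * (((1 + |y|) ^ k)⁻¹ * ‖h y‖))
    (Metric.ball_mem_nhds x one_pos)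
    (Eventually.of_forall fun z => aestronglyMeasurable_translate_mul hh κ z)
    (integrable_translate_mul hh κ x)
    (aestronglyMeasurable_translate_mul hh _ x).neg
    (Eventually.of_forall fun y z hz => ?_) (hk.const_mul _)
    (Eventually.of_forall fun y z _ => ?_)).2
  · rw [integral_neg] at this
    exact this
  · have hz' : |z| ≤ 1 + |x| := by
      rw [Metric.mem_ball, Real.dist_eq] at hz
      have := abs_add_le (z - x) x
      rw [sub_add_cancel] at this
      linarith
    rw [norm_neg, norm_mul, ← mul_assoc]
    gcongr
    refine (hb z y).trans ?_
    gcongr C * ?_ ^ k * _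
    linarith
  · have h1 : HasDerivAt (fun z : ℝ => y - z) (-1) z := by
      simpa using (hasDerivAt_id z).const_sub y
    have h2 := ((κ.hasDerivAt (y - z)).scomp z h1).mul_const (h y)
    refine h2.congr_deriv ?_
    rw [SchwartzMap.derivCLM_apply, neg_one_smul, neg_mul]

/-- The derivative is again a correlation, with -κ' in place of κ, so the induction runs over all κ.
-/
theorem contDiff_correlation {h : ℝ → ℂ} (hh : PolyIntegrable h) (κ : 𝓢(ℝ, ℂ)) :
    ContDiff ℝ ((⊤ : ℕ∞) : WithTop ℕ∞) (correlation h κ) := by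
  refine contDiff_infty.2 fun n => ?_
  induction n generalizing κ with
  | zero =>
    exact contDiff_zero.2
      (continuous_iff_continuousAt.2 fun x => (hasDerivAt_correlation hh κ x).continuousAt)
  | succ n ih =>
    push_cast
    refine contDiff_succ_iff_deriv.2
      ⟨fun x => (hasDerivAt_correlation hh κ x).differentiableAt, by simp, ?_⟩
    rw [funext fun x => (hasDerivAt_correlation hh κ x).deriv]
    exact (ih _).neg

theorem integrable_prod_translate {h : ℝ → ℂ} (hh : PolyIntegrable h) (κ φ : 𝓢(ℝ, ℂ)) :
    Integrable (Function.uncurry fun x y : ℝ => φ x * (κ (y - x) * h y)) (volume.prod volume) := by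
  obtain ⟨k, hk⟩ := hh.norm_integrable
  obtain ⟨C, hC, hb⟩ := exists_translate_bound κ k
  refine (((integrable_pow_mul_schwartz φ k).const_mul C).mul_prod hk).mono' ?_
    (Eventually.of_forall fun p => ?_)
  · have h1 : Continuous fun p : ℝ × ℝ => φ p.1 := φ.continuous.comp continuous_fst
    have h2 : Continuous fun p : ℝ × ℝ => κ (p.2 - p.1) :=
      κ.continuous.comp (continuous_snd.sub continuous_fst)
    exact h1.aestronglyMeasurable.mul
      (h2.aestronglyMeasurable.mul (hh.aestronglyMeasurable.comp_snd))
  · obtain ⟨x, y⟩ := p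
    simp only [Function.uncurry]
    rw [norm_mul, norm_mul]
    calc ‖φ x‖ * (‖κ (y - x)‖ * ‖h y‖)
        ≤ ‖φ x‖ * (C * (1 + |x|) ^ k * ((1 + |y|) ^ k)⁻¹ * ‖h y‖) := by
          gcongr
          exact hb x y
      _ = _ := by ring

theorem integrable_mul_correlation {h : ℝ → ℂ} (hh : PolyIntegrable h) (κ φ : 𝓢(ℝ, ℂ)) :
    Integrable fun x => φ x * correlation h κ x := by
  refine (integrable_prod_translate hh κ φ).integral_prod_left.congr
    (Eventually.of_forall fun x => ?_)
  simp only [Function.uncurry, correlation]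
  rw [integral_const_mul]

theorem integral_mul_correlation {h : ℝ → ℂ} (hh : PolyIntegrable h) (κ φ : 𝓢(ℝ, ℂ)) :
    ∫ x, φ x * correlation h κ x = ∫ y, (∫ x, κ (y - x) * φ x) * h y := by
  calc _ = ∫ x, ∫ y, φ x * (κ (y - x) * h y) := by
        simp only [correlation, integral_const_mul]
    _ = ∫ y, ∫ x, φ x * (κ (y - x) * h y) :=
        integral_integral_swap (integrable_prod_translate hh κ φ)
    _ = _ := by
        refine integral_congr_ae (Eventually.of_forall fun y => ?_)
        simp only
        rw [← integral_mul_const]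
        refine integral_congr_ae (Eventually.of_forall fun x => ?_)
        simp only
        ring

/-! ### The inverse Fourier transform of `χ (ξ ∓ i0)^a` for a Schwartz function `χ` -/

theorem boundaryPow_apply_of_re_neg (σ : ℤˣ) {a : ℂ} (ha : a.re < 0) (φ : 𝓢(ℝ, ℂ)) :
    boundaryPow σ a φ = homConst σ a * ∫ x, fourierS φ x * halfPow σ (-a - 1) x := by
  rw [(isBoundaryPow_of_re_neg σ ha).eq_boundaryPow]
  change phase σ a * homPowDivGamma σ (-a - 1) (fourierS φ) = _
  rw [homPowDivGamma_apply_of_re σ (by simpa using ha), sub_add_cancel, homConst_eq, mul_assoc]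

/-- The function `x ↦ (2π)^(-1/2) ⟨(ξ ∓ i0)^a, χ e^{i x ξ}⟩`. -/
def localPart (σ : ℤˣ) (a : ℂ) (χ : 𝓢(ℝ, ℂ)) (x : ℝ) : ℂ :=
  (Real.sqrt (2 * Real.pi) : ℂ)⁻¹ * boundaryPow σ a (modulate x χ)

/-- Reduces every exponent to Re a < 0; the new ξχ no longer equals 1 near 0, which is why χ is an
arbitrary Schwartz function. -/
theorem localPart_eq_sub_one (σ : ℤˣ) (a : ℂ) (χ : 𝓢(ℝ, ℂ)) :
    localPart σ a χ = localPart σ (a - 1) (mulId χ) := by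
  funext x
  have := boundaryPow_add_one_apply σ (a - 1) (modulate x χ)
  rw [sub_add_cancel] at this
  rw [localPart, localPart, this, mulId_modulate]

theorem localPart_of_re_neg (σ : ℤˣ) {a : ℂ} (ha : a.re < 0) (χ : 𝓢(ℝ, ℂ)) (x : ℝ) :
    localPart σ a χ x = (Real.sqrt (2 * Real.pi) : ℂ)⁻¹ * homConst σ a *
      correlation (halfPow σ (-a - 1)) (fourierS χ) x := by
  rw [localPart, boundaryPow_apply_of_re_neg σ ha, correlation, mul_assoc]
  simp only [fourierS_modulate]

theorem re_sub_one_lt {a : ℂ} {n : ℕ} (h : a.re < ((n + 1 : ℕ) : ℝ)) : (a - 1).re < n := by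
  push_cast at h
  simp only [Complex.sub_re, Complex.one_re]
  linarith

theorem contDiff_localPart (σ : ℤˣ) (a : ℂ) (χ : 𝓢(ℝ, ℂ)) :
    ContDiff ℝ ((⊤ : ℕ∞) : WithTop ℕ∞) (localPart σ a χ) := by
  obtain ⟨n, hn⟩ := exists_nat_gt a.re
  induction n generalizing a χ with
  | zero =>
    have ha : a.re < 0 := by simpa using hn
    rw [funext (localPart_of_re_neg σ ha χ)]
    exact contDiff_const.mul
      (contDiff_correlation (halfPow_polyIntegrable σ (by simpa using ha)) _)
  | succ n ih =>
    rw [localPart_eq_sub_one]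
    exact ih _ _ (re_sub_one_lt hn)

theorem mulId_mulS (χ φ : 𝓢(ℝ, ℂ)) : mulId (mulS χ φ) = mulS (mulId χ) φ := by
  ext ξ
  simp only [mulId_apply, mulS_apply, mul_assoc]

/-- Identifies F⁻¹[χ (ξ ∓ i0)^a] with the function `localPart`: for Re a < 0 by the convolution
theorem and Fubini, otherwise by moving ξ into χ. -/
theorem boundaryPow_mulS_invFourierS (σ : ℤˣ) (a : ℂ) (χ φ : 𝓢(ℝ, ℂ)) :
    Integrable (fun x => φ x * localPart σ a χ x) ∧
      boundaryPow σ a (mulS χ (invFourierS φ)) = ∫ x, φ x * localPart σ a χ x := by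
  obtain ⟨n, hn⟩ := exists_nat_gt a.re
  induction n generalizing a χ with
  | zero =>
    have ha : a.re < 0 := by simpa using hn
    have hp := halfPow_polyIntegrable σ (s := -a - 1) (by simpa using ha)
    have he : (fun x => φ x * localPart σ a χ x) = fun x =>
        (Real.sqrt (2 * Real.pi) : ℂ)⁻¹ * homConst σ a *
          (φ x * correlation (halfPow σ (-a - 1)) (fourierS χ) x) := by
      funext x
      rw [localPart_of_re_neg σ ha]
      ring
    rw [he]
    refine ⟨(integrable_mul_correlation hp _ _).const_mul _, ?_⟩
    rw [integral_const_mul, integral_mul_correlation hp, boundaryPow_apply_of_re_neg σ ha,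
      mul_comm _ (homConst σ a), mul_assoc,
      ← integral_const_mul (Real.sqrt (2 * Real.pi) : ℂ)⁻¹]
    congr 1
    refine integral_congr_ae (Eventually.of_forall fun y => ?_)
    simp only
    rw [fourierS_mulS_invFourierS, mul_assoc]
  | succ n ih =>
    have h := boundaryPow_add_one_apply σ (a - 1) (mulS χ (invFourierS φ))
    rw [sub_add_cancel, mulId_mulS] at h
    rw [h, localPart_eq_sub_one]
    exact ih _ _ (re_sub_one_lt hn)

/-! ### Powers on the punctured line -/

theorem halfPow_eq_cexp {σ : ℤˣ} (s : ℂ) {x : ℝ} (hx : 0 < sgn σ * x) :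
    halfPow σ s x = Complex.exp (s * (Real.log x : ℝ)) := by
  have hx0 : x ≠ 0 := by
    rintro rfl
    simp at hx
  rw [halfPow, if_pos hx, Complex.cpow_def_of_ne_zero (by exact_mod_cast abs_ne_zero.2 hx0),
    ← Complex.ofReal_log (abs_nonneg x), Real.log_abs, mul_comm]

theorem eventually_halfPow_eq (σ : ℤˣ) (s : ℂ) {x : ℝ} (hx : x ≠ 0) :
    (halfPow σ s =ᶠ[𝓝 x] fun y => Complex.exp (s * (Real.log y : ℝ))) ∨
      halfPow σ s =ᶠ[𝓝 x] fun _ => 0 := by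
  have hc : ContinuousAt (fun y => sgn σ * y) x := by fun_prop
  rcases lt_or_gt_of_ne (mul_ne_zero (sgn_ne_zero σ) hx) with h | h
  · right
    filter_upwards [hc.eventually_lt_const h] with y hy
    exact if_neg hy.not_gt
  · left
    filter_upwards [hc.eventually_const_lt h] with y hy
    exact halfPow_eq_cexp s hy

theorem contDiffAt_halfPow (σ : ℤˣ) (s : ℂ) {x : ℝ} (hx : x ≠ 0) :
    ContDiffAt ℝ ((⊤ : ℕ∞) : WithTop ℕ∞) (halfPow σ s) x := by
  rcases eventually_halfPow_eq σ s hx with h | h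
  · refine ContDiffAt.congr_of_eventuallyEq ?_ h
    have hl : ContDiffAt ℝ ((⊤ : ℕ∞) : WithTop ℕ∞) (fun y : ℝ => ((Real.log y : ℝ) : ℂ)) x :=
      Complex.ofRealCLM.contDiff.contDiffAt.comp x (Real.contDiffAt_log.2 hx)
    exact (contDiffAt_const.mul hl).cexp
  · exact contDiffAt_const.congr_of_eventuallyEq h

theorem hasDerivAt_halfPow (σ : ℤˣ) (s : ℂ) {x : ℝ} (hx : x ≠ 0) :
    HasDerivAt (halfPow σ s) (s * halfPow σ s x / x) x := by
  rcases eventually_halfPow_eq σ s hx with h | h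
  · have h1 := (((Real.hasDerivAt_log hx).ofReal_comp).const_mul s).cexp
    refine (h1.congr_of_eventuallyEq h).congr_deriv ?_
    rw [h.eq_of_nhds]
    push_cast
    ring
  · refine ((hasDerivAt_const x (0 : ℂ)).congr_of_eventuallyEq h).congr_deriv ?_
    rw [h.eq_of_nhds]
    simp

theorem mul_halfPow (σ : ℤˣ) (s : ℂ) (x : ℝ) :
    (x : ℂ) * halfPow σ s x = sgn σ * halfPow σ (s + 1) x := by
  unfold halfPow
  split_ifs with h
  · have hx0 : x ≠ 0 := by
      rintro rfl
      simp at h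
    have h1 : |x| = sgn σ * x := by
      rw [← abs_of_pos h, abs_mul, abs_sgn, one_mul]
    have h2 : ((|x| : ℝ) : ℂ) ≠ 0 := by exact_mod_cast abs_ne_zero.2 hx0
    rw [Complex.cpow_add _ _ h2, Complex.cpow_one]
    have h3 : ((|x| : ℝ) : ℂ) = sgn σ * x := by
      rw [h1]
      push_cast
      rfl
    linear_combination -(sgn σ : ℂ) * (((|x| : ℝ) : ℂ) ^ s) * h3 -
      x * (((|x| : ℝ) : ℂ) ^ s) * sgn_mul_self σ
  · simp

/-- The function `√(2π) / Γ(-a) e^{∓ iπa/2} x_±^{-a-1}`. -/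
def homFun (σ : ℤˣ) (a : ℂ) (x : ℝ) : ℂ := homConst σ a * halfPow σ (-a - 1) x

theorem mul_homConst (σ : ℤˣ) (a : ℂ) :
    Complex.I * sgn σ * homConst σ a = -a * homConst σ (a - 1) := by
  have hp := phase_add_one σ (a - 1)
  rw [sub_add_cancel] at hp
  have hΓ : (Complex.Gamma (-a))⁻¹ = -a * (Complex.Gamma (-(a - 1)))⁻¹ := by
    -- At a = 0 the conventions `Gamma 0 = 0` and `0⁻¹ = 0` give 1/Γ its true value 0 at the pole.
    rcases eq_or_ne a 0 with rfl | h
    · simp [Complex.Gamma_zero]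
    · have h1 : -(a - 1) = -a + 1 := by ring
      rw [h1, Complex.Gamma_add_one _ (neg_ne_zero.2 h), mul_inv,
        mul_inv_cancel_left₀ (neg_ne_zero.2 h)]
  rw [homConst_eq, homConst_eq, hp, hΓ]
  linear_combination (-(sgn σ : ℂ) * sgn σ * phase σ (a - 1) * (-a) *
    (Complex.Gamma (-(a - 1)))⁻¹) * Complex.I_mul_I + (phase σ (a - 1) * (-a) *
    (Complex.Gamma (-(a - 1)))⁻¹) * sgn_mul_self σ

theorem mul_homFun (σ : ℤˣ) (a : ℂ) (x : ℝ) :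
    Complex.I * x * homFun σ a x = -a * homFun σ (a - 1) x := by
  have h1 := mul_halfPow σ (-a - 1) x
  have h2 : -(a - 1) - 1 = -a - 1 + 1 := by ring
  rw [homFun, homFun, h2, ← mul_assoc (-a), ← mul_homConst]
  linear_combination Complex.I * homConst σ a * h1

theorem hasDerivAt_homFun (σ : ℤˣ) (a : ℂ) {x : ℝ} (hx : x ≠ 0) :
    HasDerivAt (homFun σ a) (Complex.I * homFun σ (a + 1) x) x := by
  refine ((hasDerivAt_halfPow σ (-a - 1) hx).const_mul (homConst σ a)).congr_deriv ?_
  have h := mul_homFun σ (a + 1) x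
  have hx' : (x : ℂ) ≠ 0 := by exact_mod_cast hx
  rw [add_sub_cancel_right] at h
  field_simp
  rw [homFun] at h ⊢
  rw [homFun] at h
  linear_combination -h

theorem contDiffAt_homFun (σ : ℤˣ) (a : ℂ) {x : ℝ} (hx : x ≠ 0) :
    ContDiffAt ℝ ((⊤ : ℕ∞) : WithTop ℕ∞) (homFun σ a) x :=
  contDiffAt_const.mul (contDiffAt_halfPow σ _ hx)

theorem invFourierD_boundaryPow_of_re_neg (σ : ℤˣ) {a : ℂ} (ha : a.re < 0) (φ : 𝓢(ℝ, ℂ)) :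
    Integrable (fun x => φ x * homFun σ a x) ∧
      boundaryPow σ a (invFourierS φ) = ∫ x, φ x * homFun σ a x := by
  obtain ⟨_, _, _, hi⟩ := (halfPow_polyIntegrable σ (s := -a - 1) (by simpa using ha)).exists_bound
  have he : (fun x => φ x * homFun σ a x) = fun x =>
      homConst σ a * (φ x * halfPow σ (-a - 1) x) := by
    funext x
    rw [homFun]
    ring
  rw [he]
  refine ⟨(hi φ).1.const_mul _, ?_⟩
  rw [integral_const_mul, boundaryPow_apply_of_re_neg σ ha, fourierS_invFourierS]

theorem exists_eq_zero_of_abs_lt {f : ℝ → ℂ} (h : f =ᶠ[𝓝 0] 0) :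
    ∃ ε > 0, ∀ x, |x| < ε → f x = 0 := by
  obtain ⟨ε, hε, hb⟩ := Metric.eventually_nhds_iff.1 h
  exact ⟨ε, hε, fun x hx => hb (by simpa using hx)⟩

/-- The statement for a - 1 is differentiated; a test function vanishing near 0 permits integration
by parts across the singularity. -/
theorem isGivenOn_invFourierD_boundaryPow (σ : ℤˣ) (a : ℂ) :
    IsGivenOn (invFourierD (boundaryPow σ a)) (homFun σ a) {0}ᶜ := by
  obtain ⟨n, hn⟩ := exists_nat_gt a.re
  induction n generalizing a with
  | zero =>
    intro φ _
    exact invFourierD_boundaryPow_of_re_neg σ (by simpa using hn) φ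
  | succ n ih =>
    intro φ hφ
    have h0 := ih (a - 1) (re_sub_one_lt hn)
    have hi0 := (h0 φ hφ).1
    have hd := h0 (SchwartzMap.derivCLM ℂ ℂ φ) ((SchwartzMap.tsupport_derivCLM_subset ℂ φ).trans hφ)
    have hev : (φ : ℝ → ℂ) =ᶠ[𝓝 0] 0 :=
      notMem_tsupport_iff_eventuallyEq.1 fun h => hφ h rfl
    obtain ⟨ε, hε, hz⟩ := exists_eq_zero_of_abs_lt hev
    have hi : Integrable fun x => φ x * homFun σ a x := by
      -- By `mul_homFun`, `homFun σ a` is ia/x times `homFun σ (a - 1)`, and this multiplier is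
      -- bounded by |a|/ε where φ may be nonzero.
      have hm : Integrable fun x : ℝ => (if |x| < ε then 0 else Complex.I * a / x) *
          (φ x * homFun σ (a - 1) x) := by
        refine hi0.bdd_mul (c := ‖a‖ / ε) ?_ (Eventually.of_forall fun x => ?_)
        · exact (Measurable.ite (measurableSet_lt (by fun_prop) measurable_const) measurable_const
            (by fun_prop)).aestronglyMeasurable
        · split_ifs with h
          · rw [norm_zero]
            positivity
          · rw [norm_div, norm_mul, Complex.norm_I, one_mul, Complex.norm_real, Real.norm_eq_abs]
            gcongr
            exact not_lt.1 h
      refine hm.congr (Eventually.of_forall fun x => ?_)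
      simp only
      split_ifs with h
      · rw [hz x h]
        simp
      · have hx : (x : ℂ) ≠ 0 := by
          have : x ≠ 0 := fun h0 => h (by simpa [h0] using hε)
          exact_mod_cast this
        have := mul_homFun σ a x
        field_simp
        linear_combination φ x * Complex.I * this - φ x * homFun σ a x * x * Complex.I_mul_I
    refine ⟨hi, ?_⟩
    have hder : ∀ x : ℝ, HasDerivAt (fun x => φ x * homFun σ (a - 1) x)
        (SchwartzMap.derivCLM ℂ ℂ φ x * homFun σ (a - 1) x +
          Complex.I * (φ x * homFun σ a x)) x := by
      intro x
      rcases eq_or_ne x 0 with rfl | hx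
      · have he : (fun x => φ x * homFun σ (a - 1) x) =ᶠ[𝓝 0] fun _ => 0 := by
          filter_upwards [hev] with y hy
          rw [hy]
          simp
        refine ((hasDerivAt_const (0 : ℝ) (0 : ℂ)).congr_of_eventuallyEq he).congr_deriv ?_
        rw [SchwartzMap.derivCLM_apply, hev.deriv_eq, hev.eq_of_nhds]
        simp
      · refine ((φ.hasDerivAt x).mul (hasDerivAt_homFun σ (a - 1) hx)).congr_deriv ?_
        rw [SchwartzMap.derivCLM_apply, sub_add_cancel]
        ring
    have h1 := integral_eq_zero_of_hasDerivAt_of_integrable hder (hd.1.add (hi.const_mul _)) hi0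
    rw [integral_add hd.1 (hi.const_mul _), integral_const_mul, ← hd.2] at h1
    have h2 := congrArg (fun T : 𝓢'(ℝ, ℂ) => T φ) (derivCLM_invFourierD_boundaryPow σ (a - 1))
    simp only [sub_add_cancel] at h2
    change invFourierD (boundaryPow σ (a - 1)) (-SchwartzMap.derivCLM ℂ ℂ φ) =
      Complex.I * invFourierD (boundaryPow σ a) φ at h2
    rw [map_neg] at h2
    refine mul_left_cancel₀ Complex.I_ne_zero ?_
    linear_combination -h2 - h1

/-! ### Decay -/

theorem mul_boundaryPow_modulate (σ : ℤˣ) (a : ℂ) (χ : 𝓢(ℝ, ℂ)) (x : ℝ) :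
    Complex.I * x * boundaryPow σ a (modulate x χ) =
      -(a * boundaryPow σ (a - 1) (modulate x χ)) -
        boundaryPow σ a (modulate x (SchwartzMap.derivCLM ℂ ℂ χ)) := by
  have h := boundaryPow_apply_derivCLM σ a (modulate x χ)
  rw [derivCLM_modulate, map_add, map_smul, smul_eq_mul] at h
  linear_combination h

theorem derivCLM_eventuallyEq_zero {χ : 𝓢(ℝ, ℂ)} (hχ : (χ : ℝ → ℂ) =ᶠ[𝓝 0] 0) :
    (SchwartzMap.derivCLM ℂ ℂ χ : ℝ → ℂ) =ᶠ[𝓝 0] 0 := by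
  have h := hχ.deriv
  filter_upwards [h] with x hx
  rw [SchwartzMap.derivCLM_apply, hx]
  simp

/-- Where χ ≠ 0 one has |ξ ∓ iη| ≥ ε uniformly in η, and modulation does not change absolute values.
-/
theorem exists_bound_boundaryPow_modulate (σ : ℤˣ) (a : ℂ) {χ : 𝓢(ℝ, ℂ)}
    (hχ : (χ : ℝ → ℂ) =ᶠ[𝓝 0] 0) :
    ∃ C : ℝ, ∀ x : ℝ, ‖boundaryPow σ a (modulate x χ)‖ ≤ C := by
  obtain ⟨ε, hε, hz⟩ := exists_eq_zero_of_abs_lt hχ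
  refine ⟨_, fun x => (isBoundaryPow_boundaryPow σ a).norm_apply_le (modulate x χ)
    ((integrable_pow_mul_schwartz χ ⌈a.re⌉₊).const_mul
      ((ε ^ a.re + 1) * Real.exp (Real.pi * |a.im|))) fun ξ η hη hη1 => ?_⟩
  rw [norm_modulate_apply]
  rcases lt_or_ge |ξ| ε with h | h
  · rw [hz ξ h, norm_zero, zero_mul, mul_zero, mul_zero]
  · rw [mul_comm, ← mul_assoc]
    gcongr
    exact norm_cpow_le_of_bounds a hε (by linarith [abs_nonneg ξ])
      (h.trans (abs_le_norm_shiftedPt σ η ξ)) (norm_shiftedPt_le σ hη hη1 ξ)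

/-- Each factor x is exchanged for a - 1 or for χ', and χ' still vanishes near 0. -/
theorem exists_bound_pow_mul_boundaryPow_modulate (σ : ℤˣ) (n : ℕ) (a : ℂ) {χ : 𝓢(ℝ, ℂ)}
    (hχ : (χ : ℝ → ℂ) =ᶠ[𝓝 0] 0) :
    ∃ C : ℝ, ∀ x : ℝ, |x| ^ n * ‖boundaryPow σ a (modulate x χ)‖ ≤ C := by
  induction n generalizing a χ with
  | zero => simpa using exists_bound_boundaryPow_modulate σ a hχ
  | succ n ih =>
    obtain ⟨C1, h1⟩ := ih (a - 1) hχ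
    obtain ⟨C2, h2⟩ := ih a (derivCLM_eventuallyEq_zero hχ)
    refine ⟨‖a‖ * C1 + C2, fun x => ?_⟩
    have h3 : |x| * ‖boundaryPow σ a (modulate x χ)‖ ≤
        ‖a‖ * ‖boundaryPow σ (a - 1) (modulate x χ)‖ +
          ‖boundaryPow σ a (modulate x (SchwartzMap.derivCLM ℂ ℂ χ))‖ := by
      have := congrArg norm (mul_boundaryPow_modulate σ a χ x)
      rw [norm_mul, norm_mul, Complex.norm_I, one_mul, Complex.norm_real, Real.norm_eq_abs] at this
      rw [this]
      refine (norm_sub_le _ _).trans ?_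
      rw [norm_neg, norm_mul]
    calc _ = |x| ^ n * (|x| * ‖boundaryPow σ a (modulate x χ)‖) := by ring
      _ ≤ |x| ^ n * (‖a‖ * ‖boundaryPow σ (a - 1) (modulate x χ)‖ +
          ‖boundaryPow σ a (modulate x (SchwartzMap.derivCLM ℂ ℂ χ))‖) := by gcongr
      _ = ‖a‖ * (|x| ^ n * ‖boundaryPow σ (a - 1) (modulate x χ)‖) +
          |x| ^ n * ‖boundaryPow σ a (modulate x (SchwartzMap.derivCLM ℂ ℂ χ))‖ := by ring
      _ ≤ ‖a‖ * C1 + C2 := by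
        gcongr
        · exact h1 x
        · exact h2 x

/-- Testing against bumps of mass one concentrated at x₀ turns an L¹-dual bound into a pointwise
one. -/
theorem norm_le_of_norm_integral_le {g : ℝ → ℂ} {M : ℝ} {x₀ : ℝ} (hg : ContinuousAt g x₀)
    (hi : ∀ φ : 𝓢(ℝ, ℂ), Integrable fun x => φ x * g x)
    (h : ∀ φ : 𝓢(ℝ, ℂ), ‖∫ x, φ x * g x‖ ≤ M * ∫ x, ‖φ x‖) : ‖g x₀‖ ≤ M := by
  refine le_of_forall_pos_le_add fun ε hε => ?_
  obtain ⟨δ, hδ, hb⟩ := Metric.continuousAt_iff.1 hg ε hε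
  let b : ContDiffBump x₀ := ⟨δ / 2, δ, by positivity, by linarith⟩
  let β : ℝ → ℝ := b.normed volume
  have hβ0 : ∀ x, 0 ≤ β x := b.nonneg_normed
  have hβ1 : ∫ x, β x = 1 := b.integral_normed
  have hcs : HasCompactSupport fun x => (β x : ℂ) :=
    b.hasCompactSupport_normed.comp_left Complex.ofReal_zero
  have hcd : ContDiff ℝ ((⊤ : ℕ∞) : WithTop ℕ∞) fun x => (β x : ℂ) :=
    Complex.ofRealCLM.contDiff.comp b.contDiff_normed
  let φ : 𝓢(ℝ, ℂ) := hcs.toSchwartzMap hcd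
  have hφ : ∀ x, φ x = (β x : ℂ) := fun x => rfl
  have hn : ∀ x, ‖φ x‖ = β x := fun x => by
    rw [hφ, Complex.norm_real, Real.norm_of_nonneg (hβ0 x)]
  have hφ1 : ∫ x, φ x = 1 := by
    simp only [hφ, integral_complex_ofReal, hβ1, Complex.ofReal_one]
  have h1 := h φ
  simp only [hn, hβ1, mul_one] at h1
  have h2 : ∫ x, φ x * (g x₀ - g x) = g x₀ - ∫ x, φ x * g x := by
    simp only [mul_sub]
    rw [integral_sub (φ.integrable.mul_const _) (hi φ), integral_mul_const, hφ1, one_mul]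
  have h3 : ‖∫ x, φ x * (g x₀ - g x)‖ ≤ ε := by
    have hβi : Integrable β := by
      simpa only [hn] using (φ.integrable (μ := volume)).norm
    have := norm_integral_le_of_norm_le (hβi.mul_const ε)
      (f := fun x => φ x * (g x₀ - g x)) (Eventually.of_forall fun x => ?_)
    · rwa [integral_mul_const, hβ1, one_mul] at this
    · rw [norm_mul, hn]
      by_cases hx : x ∈ Metric.ball x₀ δ
      · refine mul_le_mul_of_nonneg_left ?_ (hβ0 x)
        rw [← dist_eq_norm, dist_comm]
        exact (hb hx).le
      · have hx0 : β x = 0 := by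
          by_contra hne
          have : x ∈ Function.support (b.normed volume) := hne
          rw [b.support_normed_eq] at this
          exact hx this
        rw [hx0, zero_mul, zero_mul]
  calc ‖g x₀‖ = ‖(∫ x, φ x * g x) + ∫ x, φ x * (g x₀ - g x)‖ := by
        rw [h2]
        congr 1
        ring
    _ ≤ M + ε := (norm_add_le _ _).trans (add_le_add h1 h3)

theorem norm_invFourierS_apply_le (φ : 𝓢(ℝ, ℂ)) (ξ : ℝ) :
    ‖invFourierS φ ξ‖ ≤ ‖(Real.sqrt (2 * Real.pi) : ℂ)⁻¹‖ * ∫ x, ‖φ x‖ := by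
  rw [invFourierS_apply, norm_mul]
  gcongr
  refine norm_integral_le_of_norm_le (φ.integrable (μ := volume)).norm
    (Eventually.of_forall fun x => ?_)
  rw [norm_mul, norm_cexp_I_mul, one_mul]

/-- The difference between `√(2π) / Γ(-a) e^{∓ iπa/2} x_±^{-a-1}` and the inverse Fourier transform
of `χ (ξ ∓ i0)^a`. -/
def remainder (σ : ℤˣ) (a : ℂ) (χ : 𝓢(ℝ, ℂ)) (x : ℝ) : ℂ := homFun σ a x - localPart σ a χ x

theorem contDiffAt_remainder (σ : ℤˣ) (a : ℂ) (χ : 𝓢(ℝ, ℂ)) {x : ℝ} (hx : x ≠ 0) :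
    ContDiffAt ℝ ((⊤ : ℕ∞) : WithTop ℕ∞) (remainder σ a χ) x :=
  (contDiffAt_homFun σ a hx).sub (contDiff_localPart σ a χ).contDiffAt

theorem exists_norm_boundaryPow_mulS_le (σ : ℤˣ) {a : ℂ} (ha : a.re < -1) {χ : 𝓢(ℝ, ℂ)}
    (hχ : (χ : ℝ → ℂ) =ᶠ[𝓝 0] 1) :
    ∃ K : ℝ, ∀ (ψ : 𝓢(ℝ, ℂ)) (S : ℝ), (∀ ξ, ‖ψ ξ‖ ≤ S) →
      ‖boundaryPow σ a (ψ - mulS χ ψ)‖ ≤ K * S := by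
  have hχ' : (fun ξ => 1 - χ ξ) =ᶠ[𝓝 0] 0 := by
    filter_upwards [hχ] with ξ h
    simp [h]
  obtain ⟨ε, hε, hz⟩ := exists_eq_zero_of_abs_lt hχ'
  set W : ℝ := 1 + SchwartzMap.seminorm ℂ 0 0 χ
  have hW : ∀ ξ, ‖1 - χ ξ‖ ≤ W := fun ξ => by
    refine (norm_sub_le _ _).trans ?_
    rw [norm_one]
    exact add_le_add le_rfl (SchwartzMap.norm_le_seminorm ℂ χ ξ)
  have hW0 : 0 ≤ W := (norm_nonneg _).trans (hW 0)
  -- For |ξ| ≥ ε, 1 + |ξ| ≤ (ε⁻¹ + 1)|ξ| compares |ξ|^{Re a} with an integrable weight; the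
  -- exponential bounds the argument of the power and W bounds 1 - χ.
  set D : ℝ := (ε⁻¹ + 1) ^ (-a.re) * Real.exp (Real.pi * |a.im|) * W
  have hint : Integrable fun ξ : ℝ => (1 + ‖ξ‖) ^ (-(-a.re)) :=
    integrable_one_add_norm (by simpa using by linarith)
  refine ⟨D * ∫ ξ : ℝ, (1 + ‖ξ‖) ^ (-(-a.re)), fun ψ S hS => ?_⟩
  have hS0 : 0 ≤ S := (norm_nonneg _).trans (hS 0)
  refine ((isBoundaryPow_boundaryPow σ a).norm_apply_le _ ((hint.const_mul (D * S)))
    fun ξ η hη _ => ?_).trans_eq ?_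
  · have hval : (ψ - mulS χ ψ) ξ = (1 - χ ξ) * ψ ξ := by
      rw [sub_apply, mulS_apply]
      ring
    rw [hval]
    rcases lt_or_ge |ξ| ε with h | h
    · rw [hz ξ h, zero_mul, norm_zero, zero_mul]
      positivity
    · have hξ : 0 < |ξ| := hε.trans_le h
      have h1 : ‖shiftedPt σ η ξ‖ ^ a.re ≤ |ξ| ^ a.re :=
        Real.rpow_le_rpow_of_nonpos hξ (abs_le_norm_shiftedPt σ η ξ) (by linarith)
      have h2 : |ξ| ^ a.re ≤ (ε⁻¹ + 1) ^ (-a.re) * (1 + ‖ξ‖) ^ (-(-a.re)) := by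
        have h3 : 1 + |ξ| ≤ (ε⁻¹ + 1) * |ξ| := by
          have : 1 ≤ ε⁻¹ * |ξ| := by
            rw [inv_mul_eq_div, one_le_div hε]
            exact h
          linarith
        have h4 := Real.rpow_le_rpow_of_nonpos (z := a.re) (by positivity) h3 (by linarith)
        rw [Real.mul_rpow (by positivity) hξ.le] at h4
        rw [neg_neg, Real.norm_eq_abs, Real.rpow_neg (by positivity), inv_mul_eq_div,
          le_div_iff₀ (by positivity), mul_comm]
        exact h4
      calc ‖(1 - χ ξ) * ψ ξ‖ * ‖shiftedPt σ η ξ ^ a‖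
          ≤ (W * S) * (((ε⁻¹ + 1) ^ (-a.re) * (1 + ‖ξ‖) ^ (-(-a.re))) *
              Real.exp (Real.pi * |a.im|)) := by
            rw [norm_mul]
            refine mul_le_mul (mul_le_mul (hW ξ) (hS ξ) (norm_nonneg _) hW0) ?_ (norm_nonneg _)
              (mul_nonneg hW0 hS0)
            exact (norm_cpow_le_rpow_mul_exp _ a).trans
              (mul_le_mul_of_nonneg_right (h1.trans h2) (Real.exp_nonneg _))
        _ = D * S * (1 + ‖ξ‖) ^ (-(-a.re)) := by ring
  · rw [integral_const_mul]
    ring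

/-- The sup norm of F⁻¹φ is at most a constant times the L¹ norm of φ, so the remainder obeys an
L¹-dual bound, made pointwise at its points of continuity x ≠ 0. -/
theorem exists_bound_remainder_of_re_lt (σ : ℤˣ) {a : ℂ} (ha : a.re < -1) {χ : 𝓢(ℝ, ℂ)}
    (hχ : (χ : ℝ → ℂ) =ᶠ[𝓝 0] 1) : ∃ C : ℝ, ∀ x : ℝ, x ≠ 0 → ‖remainder σ a χ x‖ ≤ C := by
  obtain ⟨K, hK⟩ := exists_norm_boundaryPow_mulS_le σ ha hχ
  have h1 : ∀ φ : 𝓢(ℝ, ℂ), Integrable (fun x => φ x * remainder σ a χ x) ∧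
      boundaryPow σ a (invFourierS φ - mulS χ (invFourierS φ)) =
        ∫ x, φ x * remainder σ a χ x := by
    intro φ
    obtain ⟨h2, h3⟩ := invFourierD_boundaryPow_of_re_neg σ (by linarith : a.re < 0) φ
    obtain ⟨h4, h5⟩ := boundaryPow_mulS_invFourierS σ a χ φ
    simp only [remainder, mul_sub]
    refine ⟨h2.sub h4, ?_⟩
    rw [map_sub, integral_sub h2 h4, h3, h5]
  refine ⟨K * ‖(Real.sqrt (2 * Real.pi) : ℂ)⁻¹‖, fun x hx =>
    norm_le_of_norm_integral_le (contDiffAt_remainder σ a χ hx).continuousAt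
      (fun φ => (h1 φ).1) fun φ => ?_⟩
  rw [← (h1 φ).2, mul_assoc]
  exact hK _ _ (norm_invFourierS_apply_le φ)

theorem mul_remainder (σ : ℤˣ) (a : ℂ) (χ : 𝓢(ℝ, ℂ)) (x : ℝ) :
    Complex.I * x * remainder σ a χ x = -a * remainder σ (a - 1) χ x +
      localPart σ a (SchwartzMap.derivCLM ℂ ℂ χ) x := by
  have h1 := mul_homFun σ a x
  have h2 := mul_boundaryPow_modulate σ a χ x
  simp only [remainder, localPart]
  linear_combination h1 - (Real.sqrt (2 * Real.pi) : ℂ)⁻¹ * h2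

/-- Each power of x lowers a by one, so n of them bring the exponent below real part -1. -/
theorem exists_bound_pow_mul_remainder (σ : ℤˣ) (n : ℕ) {a : ℂ} (ha : a.re < -1 + n)
    {χ : 𝓢(ℝ, ℂ)} (hχ : (χ : ℝ → ℂ) =ᶠ[𝓝 0] 1) :
    ∃ C : ℝ, ∀ x : ℝ, x ≠ 0 → |x| ^ n * ‖remainder σ a χ x‖ ≤ C := by
  induction n generalizing a with
  | zero => simpa using exists_bound_remainder_of_re_lt σ (by simpa using ha) hχ
  | succ n ih =>
    obtain ⟨C1, h1⟩ := ih (a := a - 1) (by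
      push_cast at ha
      simp only [Complex.sub_re, Complex.one_re]
      linarith)
    have hχ' : (SchwartzMap.derivCLM ℂ ℂ χ : ℝ → ℂ) =ᶠ[𝓝 0] 0 := by
      filter_upwards [hχ.deriv] with x hx
      rw [SchwartzMap.derivCLM_apply, hx]
      simp
    obtain ⟨C2, h2⟩ := exists_bound_pow_mul_boundaryPow_modulate σ n a hχ'
    set c := ‖(Real.sqrt (2 * Real.pi) : ℂ)⁻¹‖
    refine ⟨‖a‖ * C1 + c * C2, fun x hx => ?_⟩
    have h3 : |x| * ‖remainder σ a χ x‖ ≤ ‖a‖ * ‖remainder σ (a - 1) χ x‖ +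
        c * ‖boundaryPow σ a (modulate x (SchwartzMap.derivCLM ℂ ℂ χ))‖ := by
      have := congrArg norm (mul_remainder σ a χ x)
      rw [norm_mul, norm_mul, Complex.norm_I, one_mul, Complex.norm_real, Real.norm_eq_abs] at this
      rw [this]
      refine (norm_add_le _ _).trans ?_
      rw [norm_mul, norm_neg, localPart, norm_mul]
    calc _ = |x| ^ n * (|x| * ‖remainder σ a χ x‖) := by ring
      _ ≤ |x| ^ n * (‖a‖ * ‖remainder σ (a - 1) χ x‖ +
          c * ‖boundaryPow σ a (modulate x (SchwartzMap.derivCLM ℂ ℂ χ))‖) := by gcongr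
      _ = ‖a‖ * (|x| ^ n * ‖remainder σ (a - 1) χ x‖) +
          c * (|x| ^ n * ‖boundaryPow σ a (modulate x (SchwartzMap.derivCLM ℂ ℂ χ))‖) := by ring
      _ ≤ ‖a‖ * C1 + c * C2 := by
        gcongr
        · exact h1 x hx
        · exact h2 x

theorem rapidlyDecreasing_remainder (σ : ℤˣ) (a : ℂ) {χ : 𝓢(ℝ, ℂ)}
    (hχ : (χ : ℝ → ℂ) =ᶠ[𝓝 0] 1) : RapidlyDecreasing (remainder σ a χ) := by
  intro N
  obtain ⟨m, hm⟩ := exists_nat_gt (a.re + 1)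
  -- The extra m powers meet the condition on Re a; they are discarded afterwards because |x| > 1.
  obtain ⟨C, hC⟩ := exists_bound_pow_mul_remainder σ (N + m) (a := a) (by
    push_cast
    have : (0 : ℝ) ≤ N := Nat.cast_nonneg N
    linarith) hχ
  refine Asymptotics.IsBigO.of_bound C ?_
  filter_upwards [(isCompact_Icc (a := (-1 : ℝ)) (b := 1)).compl_mem_cocompact] with x hx
  have hx1 : 1 < |x| := by
    by_contra h
    exact hx (abs_le.1 (not_lt.1 h))
  have hx0 : x ≠ 0 := by
    rintro rfl
    norm_num at hx1
  rw [max_eq_right hx1.le, norm_inv, norm_pow, Real.norm_eq_abs, abs_abs, ← div_eq_mul_inv,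
    le_div_iff₀ (by positivity), mul_comm]
  refine le_trans ?_ (hC x hx0)
  gcongr
  · exact hx1.le
  · omega

/-! ### Cut-off functions -/

/-- A cut-off function as a Schwartz function. -/
def IsCutoff.toSchwartz {ω : ℝ → ℝ} (hω : IsCutoff ω) : 𝓢(ℝ, ℂ) :=
  HasCompactSupport.toSchwartzMap (f := fun x => (ω x : ℂ))
    (hω.compact.comp_left Complex.ofReal_zero) (Complex.ofRealCLM.contDiff.comp hω.smooth)

theorem IsCutoff.toSchwartz_apply {ω : ℝ → ℝ} (hω : IsCutoff ω) (x : ℝ) :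
    hω.toSchwartz x = ω x := rfl

theorem IsCutoff.toSchwartz_eventuallyEq {ω : ℝ → ℝ} (hω : IsCutoff ω) :
    (hω.toSchwartz : ℝ → ℂ) =ᶠ[𝓝 0] 1 := by
  filter_upwards [hω.eq_one] with x hx
  rw [hω.toSchwartz_apply, hx]
  simp

theorem IsCutoff.mulFun_apply {ω : ℝ → ℝ} (hω : IsCutoff ω) (T : 𝓢'(ℝ, ℂ)) (φ : 𝓢(ℝ, ℂ)) :
    mulFun ω T φ = T (mulS hω.toSchwartz φ) := rfl

theorem IsCutoff.mulFun_one_sub_apply {ω : ℝ → ℝ} (hω : IsCutoff ω) (T : 𝓢'(ℝ, ℂ))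
    (φ : 𝓢(ℝ, ℂ)) : mulFun (fun ξ => 1 - ω ξ) T φ = T (φ - mulS hω.toSchwartz φ) := by
  have hg : Function.HasTemperateGrowth fun ξ : ℝ => ((1 - ω ξ : ℝ) : ℂ) := by
    have he : (fun ξ : ℝ => ((1 - ω ξ : ℝ) : ℂ)) = (fun _ => (1 : ℂ)) -
        (hω.toSchwartz : ℝ → ℂ) := by
      funext ξ
      simp [hω.toSchwartz_apply]
    rw [he]
    exact (Function.HasTemperateGrowth.const 1).sub hω.toSchwartz.hasTemperateGrowth
  change T (SchwartzMap.smulLeftCLM ℂ (fun ξ : ℝ => ((1 - ω ξ : ℝ) : ℂ)) φ) = _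
  congr 1
  ext ξ
  rw [SchwartzMap.smulLeftCLM_apply_apply hg, sub_apply, mulS_apply, hω.toSchwartz_apply,
    smul_eq_mul]
  push_cast
  ring

end HomDist

end

/-! ### Assembly of the proposition -/

open HomDist in
theorem mainTheorem5 (ω : ℝ → ℝ) (hω : IsCutoff ω) (a : ℂ) (σ : ℤˣ) :
    -- the distribution `(ξ ∓ i0)^a` exists
    IsBoundaryPow σ a (boundaryPow σ a) ∧
    -- its inverse Fourier transform
    (invFourierD (boundaryPow σ a) =
      ((Real.sqrt (2 * Real.pi) : ℂ) *
        Complex.exp (-(sgn σ : ℂ) * Complex.I * Real.pi * a / 2)) • homPowDivGamma σ (-a - 1)) ∧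
    ((∀ n : ℕ, a ≠ n) →
      invFourierD (boundaryPow σ a) = homConst σ a • homPow σ (-a - 1)) ∧
    invFourierD (fourierD (homPow σ a)) = homPow σ a ∧
    -- the parts near zero and near infinity
    (invFourierD (boundaryPow σ a) =
      invFourierD (mulFun ω (boundaryPow σ a)) +
        invFourierD (mulFun (fun ξ => 1 - ω ξ) (boundaryPow σ a))) ∧
    (∃ g : ℝ → ℂ, ContDiffOn ℝ ((⊤ : ℕ∞) : WithTop ℕ∞) g {0}ᶜ ∧
      IsGivenOn (invFourierD (mulFun (fun ξ => 1 - ω ξ) (boundaryPow σ a))) g {0}ᶜ ∧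
      RapidlyDecreasing g) ∧
    (∃ f : ℝ → ℂ, ContDiff ℝ ((⊤ : ℕ∞) : WithTop ℕ∞) f ∧
      IsGivenOn (invFourierD (mulFun ω (boundaryPow σ a))) f Set.univ ∧
      RapidlyDecreasing (fun x => f x - homConst σ a * halfPow σ (-a - 1) x)) ∧
    -- the derivative
    TemperedDistribution.derivCLM ℂ (invFourierD (boundaryPow σ a)) =
      Complex.I • invFourierD (boundaryPow σ (a + 1)) := by
  set T := boundaryPow σ a
  set χ := hω.toSchwartz
  have hχ := hω.toSchwartz_eventuallyEq
  have hf : IsGivenOn (invFourierD (mulFun ω T)) (localPart σ a χ) Set.univ := fun φ _ => by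
    refine ⟨(boundaryPow_mulS_invFourierS σ a χ φ).1, ?_⟩
    rw [← (boundaryPow_mulS_invFourierS σ a χ φ).2]
    exact hω.mulFun_apply T (invFourierS φ)
  have hsub : ∀ φ : SchwartzMap ℝ ℂ, invFourierD (mulFun (fun ξ => 1 - ω ξ) T) φ =
      invFourierD T φ - invFourierD (mulFun ω T) φ := fun φ => by
    change mulFun (fun ξ => 1 - ω ξ) T (invFourierS φ) =
      T (invFourierS φ) - mulFun ω T (invFourierS φ)
    rw [hω.mulFun_one_sub_apply, hω.mulFun_apply, map_sub]
  refine ⟨isBoundaryPow_boundaryPow σ a, invFourierD_boundaryPow σ a,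
    invFourierD_boundaryPow_eq_homPow σ, invFourierD_fourierD _, ?_,
    ⟨remainder σ a χ, fun x hx => (contDiffAt_remainder σ a χ hx).contDiffWithinAt, ?_,
      rapidlyDecreasing_remainder σ a hχ⟩,
    ⟨localPart σ a χ, contDiff_localPart σ a χ, hf, fun N => ?_⟩,
    derivCLM_invFourierD_boundaryPow σ a⟩
  · ext φ
    rw [add_apply, hsub, add_sub_cancel]
  · intro φ hφ
    obtain ⟨h1, h2⟩ := isGivenOn_invFourierD_boundaryPow σ a φ hφ
    obtain ⟨h3, h4⟩ := hf φ (Set.subset_univ _)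
    simp only [remainder, mul_sub]
    exact ⟨h1.sub h3, by rw [hsub, h2, h4, integral_sub h1 h3]⟩
  -- The error in the expansion of the part near zero is minus the function representing the part
  -- near infinity.
  · refine (rapidlyDecreasing_remainder σ a hχ N).neg_left.congr_left fun x => ?_
    exact neg_sub _ _
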